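/- **Notation.** $\mathcal P(X)$ is the set of Borel probability measures on $X$, and $\mathcal P_c(\mathbb R)$ the set of those on $\mathbb R$ with compact support; $T\mathbb R=\mathbb R\times\mathbb R\ni(x,v)$; $B(0,R)=\,]-R,R[$; $W$ is the 1-Wasserstein distance on $\mathbb R$, with value $+\infty$ between measures of different total mass. A probability vector field (PVF) is a map $V:\mathcal P(\mathbb R)\to\mathcal P(T\mathbb R)$ such that the first marginal of $V[\mu]$ is $\mu$. For $V_1,V_2\in\mathcal P(T\mathbb R)$ with first marginals $\mu_1,\mu_2$, $\mathcal W(V_1,V_2)$ is the infimum of $\int|v-w|\,d\mathcal T(x,v,y,w)$ over the couplings $\mathcal T$ of $V_1,V_2$ whose image under $(x,v,y,w)\mapsto(x,y)$ is an optimal plan for $W(\mu_1,\mu_2)$. Consider the conditions * (H1) there is $C>0$ with $\sup_{(x,v)\in \mathrm{Supp}\,V[\mu]}|v|\le C\,(1+\sup_{x\in \mathrm{Supp}\,\mu}|x|)$ for all $\mu\in\mathcal P_c(\mathbb R)$; * (H3) for every $R>0$ there is $K>0$ with $\mathcal W(V[\mu],V[\nu])\le K\,W(\mu,\nu)$ for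 all $\mu,\nu\in\mathcal P_c(\mathbb R)$ with supports in $B(0,R)$. *Solutions.* A map $\mu:[0,T]\to\mathcal P_c(\mathbb R)$ is a solution of $\dot\mu=V[\mu]$, $\mu(0)=\mu_0$ if it satisfies the initial condition and, for every $f\in C_c^\infty(\mathbb R)$, the integral $I(s)=\int f'(x)\,v\,dV[\mu(s)](x,v)$ exists for a.e. $s\in[0,T]$, $I\in L^1(0,T)$, and $t\mapsto\int f\,d\mu(t)$ is absolutely continuous on $[0,T]$ with derivative $I(t)$ for a.e. $t$. *Lattice approximate solutions (LASs).* For $N\ge1$ let $x_i=i/N^2$ ($|i|\le N^3$) and $v_j=j/N$ ($|j|\le N^2$). Put $\mu^N_0=\sum_i\mu_0([x_i,x_i+N^{-2}[)\,\delta_{x_i}$ and, for $\ell\ge0$ and $0\le s\le 1/N$, $$\mu^N(\ell/N+s)=\sum_{i,j}V[\mu^N_\ell]\big(\{x_i\}\times[v_j,v_j+\tfrac1N[\big)\,\delta_{x_i+s v_j},\qquad \mu^N_{\ell+1}=\mu^N((\ell+1)/N).$$ (If $N$ is so small that mass leaves the grid and $\mu^N_\ell$ is not a probability measure, $V[\mu^N_\ell]$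 is replaced by $0$; for fixed $\mu_0,T$ this does not affect limits as $N\to\infty$.) A limit of LASs on $[0,T]$ is a curve $\mu:[0,T]\to\mathcal P_c(\mathbb R)$ with $\sup_{t\in[0,T]}W(\mu^N(t),\mu(t))\to0$ as $N\to\infty$, possibly along a subsequence. *Lipschitz semigroups.* If $V$ satisfies (H1) with constant $C$, a Lipschitz semigroup on $[0,T]$ is a map $S:[0,T]\times\mathcal P_c(\mathbb R)\to\mathcal P_c(\mathbb R)$ such that $S_0\mu=\mu$; $S_tS_s\mu=S_{t+s}\mu$ if $t,s,t+s\in[0,T]$; $t\mapsto S_t\mu$ is a solution with initial datum $\mu$; and for every $R>0$ there is $C(R)>0$ such that, for $\mu,\nu$ with supports in $B(0,R)$ and $t,s\in[0,T]$: $\mathrm{Supp}(S_t\mu)\subset B(0,e^{Ct}(R+1))$, $W(S_t\mu,S_t\nu)\le e^{C(R)t}W(\mu,\nu)$ and $W(S_t\mu,S_s\mu)\le C(R)|t-s|$. *The median-splitting PVF.* For $\mu\in\mathcal P(\mathbb R)$ let $B(\mu)=\sup\{x:\mu(]-\infty,x])\le\frac12\}$, $\eta(\mu)=\mu(]-\infty,B(\mu)])-\frac12$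 and $\xi(\mu)=\frac12-\mu(]-\infty,B(\mu)[)$; then $\eta(\mu),\xi(\mu)\ge0$ and $\eta(\mu)+\xi(\mu)=\mu(\{B(\mu)\})$. Let $V[\mu]=\mu\otimes\nu_x$, where $\nu_x=\delta_{-1}$ for $x<B(\mu)$, $\nu_x=\delta_1$ for $x>B(\mu)$, and $$\nu_{B(\mu)}=\frac{\eta(\mu)\,\delta_1+\xi(\mu)\,\delta_{-1}}{\mu(\{B(\mu)\})}$$ if $\mu(\{B(\mu)\})>0$ (if $\mu(\{B(\mu)\})=0$ the choice of $\nu_{B(\mu)}$ is irrelevant). **Proposition.** The median-splitting PVF $V$ satisfies (H1) and (H3), and in fact $\mathcal W(V[\mu],V[\nu])=0$ for all $\mu,\nu\in\mathcal P_c(\mathbb R)$. For every $T>0$ there is a map $S:[0,T]\times\mathcal P_c(\mathbb R)\to\mathcal P_c(\mathbb R)$ such that: 1. for every $\mu_0\in\mathcal P_c(\mathbb R)$ the whole sequence of LASs from $\mu_0$ converges on $[0,T]$ to $t\mapsto S_t\mu_0$, and no subsequence of it has another limit; 2. for every constant $C$ as in (H1), $S$ is a Lipschitz semigroup on $[0,T]$,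 and it is the only one whose trajectories are limits of LASs; 3. for every $\mu_0\in\mathcal P_c(\mathbb R)$, $t\in[0,T]$ and Borel set $A$, with $B=B(\mu_0)$, $\mu(t)=S_t\mu_0$ satisfies $$\mu(t)(A)=\mu_0\big((A\cap]-\infty,B-t[)+t\big)+\mu_0\big((A\cap]B+t,+\infty[)-t\big)+\eta(\mu_0)\,\delta_{B+t}(A)+\xi(\mu_0)\,\delta_{B-t}(A);$$ 4. for $\mu_0=\delta_{x_0}$ and $t\in[0,T]$, $S_t\mu_0=\frac12\delta_{x_0+t}+\frac12\delta_{x_0-t}$; 5. for $a<b$, $\mu_0=\frac1{b-a}\chi_{[a,b]}\lambda$ ($\lambda$ the Lebesgue measure) and $t\in[0,T]$, $S_t\mu_0=\frac1{b-a}\chi_{[a-t,\frac{a+b}2-t]}\lambda+\frac1{b-a}\chi_{[\frac{a+b}2+t,b+t]}\lambda$. -/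

import Mathlib

open MeasureTheory ProbabilityTheory Set Filter Topology
open scoped ENNReal ContDiff

noncomputable section

namespace MDE

/-! ### Probability measures with compact support, optimal transport -/

/-- The set `𝒫_c(ℝ)` of Borel probability measures on `ℝ` with compact support. -/
abbrev Pc : Type := {μ : ProbabilityMeasure ℝ // IsCompact (μ : Measure ℝ).support}

/-- The support of an element of `𝒫_c(ℝ)`. -/
def Pc.supp (μ : Pc) : Set ℝ := (μ.1 : Measure ℝ).support

section Transport

variable {X : Type*} [PseudoEMetricSpace X] [MeasurableSpace X]

/-- `τ ∈ P(μ, ν)`: `τ` is a transference plan from `μ` to `ν`. -/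
def IsPlan (τ : Measure (X × X)) (μ ν : Measure X) : Prop :=
  τ.map Prod.fst = μ ∧ τ.map Prod.snd = ν

/-- The transportation cost `J(τ) = ∫ d(x, y) dτ(x, y)`. -/
def cost (τ : Measure (X × X)) : ℝ≥0∞ := ∫⁻ p, edist p.1 p.2 ∂τ

/-- The Wasserstein distance `W(μ, ν) = inf {J(τ) : τ ∈ P(μ, ν)}`
(it is `∞` if `μ` and `ν` have different total masses). -/
def W (μ ν : Measure X) : ℝ≥0∞ := ⨅ (τ : Measure (X × X)) (_ : IsPlan τ μ ν), cost τ

/-- `τ ∈ P^opt(μ, ν)`: `τ` is a plan from `μ` to `ν` of minimal cost. -/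
def IsOptPlan (τ : Measure (X × X)) (μ ν : Measure X) : Prop :=
  IsPlan τ μ ν ∧ ∀ τ' : Measure (X × X), IsPlan τ' μ ν → cost τ ≤ cost τ'

end Transport

/-- The projection `π₁₃ (x, v, y, w) = (x, y)` on the bases. -/
def proj13 (p : (ℝ × ℝ) × (ℝ × ℝ)) : ℝ × ℝ := (p.1.1, p.2.1)

/-- For `V₁, V₂` on `Tℝ = ℝ × ℝ` with base marginals `μ₁, μ₂`, the infimum of `∫ |v - w| dT` over
the plans `T ∈ P(V₁, V₂)` whose projection on the bases is an optimal plan from `μ₁` to `μ₂`. -/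
def fiberW (V₁ V₂ : Measure (ℝ × ℝ)) : ℝ≥0∞ :=
  ⨅ (T : Measure ((ℝ × ℝ) × (ℝ × ℝ))) (_ : IsPlan T V₁ V₂)
    (_ : IsOptPlan (T.map proj13) (V₁.map Prod.fst) (V₂.map Prod.fst)),
    ∫⁻ p, edist p.1.2 p.2.2 ∂T

/-! ### Probability vector fields and measure differential equations -/

/-- A probability vector field on `ℝ`: a map `V : 𝒫(ℝ) → 𝒫(Tℝ)` with `π₁ # V[μ] = μ`. -/
structure PVF where
  /-- the underlying map -/
  toFun : ProbabilityMeasure ℝ → ProbabilityMeasure (ℝ × ℝ)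
  /-- the base marginal of `V[μ]` is `μ` -/
  base : ∀ μ, (toFun μ : Measure (ℝ × ℝ)).map Prod.fst = (μ : Measure ℝ)

/-- `V[μ]`, as a measure. -/
def PVF.meas (V : PVF) (μ : ProbabilityMeasure ℝ) : Measure (ℝ × ℝ) := V.toFun μ

/-- `C` is a constant of support sublinearity of `V`:
`sup_{(x,v) ∈ Supp V[μ]} |v| ≤ C (1 + sup_{x ∈ Supp μ} |x|)` for all `μ ∈ 𝒫_c(ℝ)`. -/
def SupportSublinear (V : PVF) (C : ℝ) : Prop :=
  ∀ μ : Pc, ∀ p ∈ (V.meas μ.1).support, |p.2| ≤ C * (1 + sSup ((fun x : ℝ => |x|) '' μ.supp))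

/-- Condition (H1): `V` is support sublinear. -/
def H1 (V : PVF) : Prop := ∃ C : ℝ, 0 < C ∧ SupportSublinear V C

/-- Condition (H3): for every `R > 0` there is `K > 0` such that
`𝒲(V[μ], V[ν]) ≤ K W(μ, ν)` whenever `Supp μ, Supp ν ⊂ B(0, R)`. -/
def H3 (V : PVF) : Prop :=
  ∀ R : ℝ, 0 < R → ∃ K : ℝ, 0 < K ∧ ∀ μ ν : Pc,
    μ.supp ⊆ Metric.ball 0 R → ν.supp ⊆ Metric.ball 0 R →
      fiberW (V.meas μ.1) (V.meas ν.1) ≤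
        ENNReal.ofReal K * W (μ.1 : Measure ℝ) (ν.1 : Measure ℝ)

/-- `ρ` (only its values on `[0, T]` matter) is a weak solution on `[0, T]` of the Cauchy problem
`ρ' = V[ρ]`, `ρ(0) = μ₀`. -/
def IsSolution (V : PVF) (T : ℝ) (μ₀ : Pc) (ρ : ℝ → Pc) : Prop :=
  ρ 0 = μ₀ ∧ ∀ f : ℝ → ℝ, ContDiff ℝ ∞ f → HasCompactSupport f →
    (∀ᵐ s ∂(volume.restrict (Icc 0 T)),
      Integrable (fun p : ℝ × ℝ => deriv f p.1 * p.2) (V.meas (ρ s).1)) ∧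
    IntegrableOn (fun s => ∫ p, deriv f p.1 * p.2 ∂(V.meas (ρ s).1)) (Icc 0 T) volume ∧
    AbsolutelyContinuousOnInterval (fun t => ∫ x, f x ∂((ρ t).1 : Measure ℝ)) 0 T ∧
    ∀ᵐ t ∂(volume.restrict (Icc 0 T)),
      HasDerivAt (fun t => ∫ x, f x ∂((ρ t).1 : Measure ℝ))
        (∫ p, deriv f p.1 * p.2 ∂(V.meas (ρ t).1)) t

/-- `S : [0, T] × 𝒫_c(ℝ) → 𝒫_c(ℝ)` (only the values `S t μ` with `t ∈ [0, T]` matter) is a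
Lipschitz semigroup for `μ' = V[μ]`, where `C` is a constant of support sublinearity of `V`. -/
structure IsLipschitzSemigroup (V : PVF) (C T : ℝ) (S : ℝ → Pc → Pc) : Prop where
  zero : ∀ μ, S 0 μ = μ
  add : ∀ μ, ∀ t ∈ Icc 0 T, ∀ s ∈ Icc 0 T, t + s ∈ Icc 0 T → S t (S s μ) = S (t + s) μ
  solution : ∀ μ, IsSolution V T μ (fun t => S t μ)
  bounds : ∀ R : ℝ, 0 < R → ∃ CR : ℝ, 0 < CR ∧ ∀ μ ν : Pc,
    μ.supp ⊆ Metric.ball 0 R → ν.supp ⊆ Metric.ball 0 R → ∀ t ∈ Icc 0 T, ∀ s ∈ Icc 0 T,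
      (S t μ).supp ⊆ Metric.ball 0 (Real.exp (C * t) * (R + 1)) ∧
      W ((S t μ).1 : Measure ℝ) ((S t ν).1 : Measure ℝ) ≤
        ENNReal.ofReal (Real.exp (CR * t)) * W (μ.1 : Measure ℝ) (ν.1 : Measure ℝ) ∧
      W ((S t μ).1 : Measure ℝ) ((S s μ).1 : Measure ℝ) ≤ ENNReal.ofReal (CR * |t - s|)

/-! ### Lattice approximate solutions -/

/-- The space grid points `x_i = i / N²`; the grid in `[-N, N]` is `-N³ ≤ i ≤ N³`. -/
def gridX (N : ℕ) (i : ℤ) : ℝ := (i : ℝ) / (N : ℝ) ^ 2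

/-- The velocity grid points `v_j = j / N`; the grid in `[-N, N]` is `-N² ≤ j ≤ N²`. -/
def gridV (N : ℕ) (j : ℤ) : ℝ := (j : ℝ) / (N : ℝ)

/-- The indices of the space grid. -/
def idxX (N : ℕ) : Finset ℤ := Finset.Icc (-(N : ℤ) ^ 3) ((N : ℤ) ^ 3)

/-- The indices of the velocity grid. -/
def idxV (N : ℕ) : Finset ℤ := Finset.Icc (-(N : ℤ) ^ 2) ((N : ℤ) ^ 2)

/-- `𝒜^x_N(μ) = ∑_i μ(x_i + [0, 1/N²[) δ_{x_i}`. -/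
def discX (N : ℕ) (μ : Measure ℝ) : Measure ℝ :=
  ∑ i ∈ idxX N, μ (Ico (gridX N i) (gridX N i + 1 / (N : ℝ) ^ 2)) • Measure.dirac (gridX N i)

/-- `m^v_{ij}(Λ) = Λ({(x_i, v) : v ∈ v_j + [0, 1/N[})`. -/
def massV (N : ℕ) (Λ : Measure (ℝ × ℝ)) (i j : ℤ) : ℝ≥0∞ :=
  Λ ({gridX N i} ×ˢ Ico (gridV N j) (gridV N j + 1 / (N : ℝ)))

/-- `∑_{ij} m^v_{ij}(Λ) δ_{x_i + s v_j}`. -/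
def advance (N : ℕ) (Λ : Measure (ℝ × ℝ)) (s : ℝ) : Measure ℝ :=
  ∑ i ∈ idxX N, ∑ j ∈ idxV N, massV N Λ i j • Measure.dirac (gridX N i + s * gridV N j)

open Classical in
/-- `V[μ]` for a measure `μ` that is a probability measure, and `0` otherwise. (The grid being
bounded, a lattice approximate solution can lose mass when `N` is small with respect to the
support of the initial datum and to the time; no mass is lost for `N` large.) -/
def PVF.ext (V : PVF) (μ : Measure ℝ) : Measure (ℝ × ℝ) :=
  if h : IsProbabilityMeasure μ then V.meas ⟨μ, h⟩ else 0

/-- The lattice approximate solution at the times `ℓ / N`. -/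
def lasStep (V : PVF) (N : ℕ) (μ₀ : Measure ℝ) : ℕ → Measure ℝ
  | 0 => discX N μ₀
  | ℓ + 1 => advance N (V.ext (lasStep V N μ₀ ℓ)) (1 / (N : ℝ))

/-- The lattice approximate solution `μ^N(t)`, `t ≥ 0`: with `ℓ = ⌊t N⌋`,
`μ^N(t) = ∑_{ij} m^v_{ij}(V[μ^N_ℓ]) δ_{x_i + (t - ℓ/N) v_j}`. -/
def las (V : PVF) (N : ℕ) (μ₀ : Measure ℝ) (t : ℝ) : Measure ℝ :=
  advance N (V.ext (lasStep V N μ₀ ⌊t * (N : ℝ)⌋₊)) (t - (⌊t * (N : ℝ)⌋₊ : ℝ) / (N : ℝ))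

/-- The lattice approximate solutions `μ^{φ(k)}` from `μ₀` converge to `ρ` as `k → ∞`, for the
Wasserstein distance and uniformly on `[0, T]`. -/
def LASTendsto (V : PVF) (T : ℝ) (μ₀ : Pc) (φ : ℕ → ℕ) (ρ : ℝ → Pc) : Prop :=
  Tendsto (fun k => ⨆ t ∈ Icc (0 : ℝ) T,
    W (las V (φ k) (μ₀.1 : Measure ℝ) t) ((ρ t).1 : Measure ℝ)) atTop (𝓝 0)

/-! ### The median-splitting probability vector field -/

/-- `B(μ) = sup {x : μ(]-∞, x]) ≤ 1/2}`. -/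
def med (μ : Measure ℝ) : ℝ := sSup {x : ℝ | μ (Iic x) ≤ 1 / 2}

/-- `η = μ(]-∞, B(μ)]) - 1/2`, the part of the mass at `B(μ)` that moves to the right. -/
def massR (μ : Measure ℝ) : ℝ≥0∞ := μ (Iic (med μ)) - 1 / 2

/-- `1/2 - μ(]-∞, B(μ)[)`, the part of the mass at `B(μ)` that moves to the left. -/
def massL (μ : Measure ℝ) : ℝ≥0∞ := 1 / 2 - μ (Iio (med μ))

theorem medSet_nonempty (μ : Measure ℝ) [IsProbabilityMeasure μ] :
    {x : ℝ | μ (Iic x) ≤ 1 / 2}.Nonempty := by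
  have hm : Antitone fun n : ℕ => Iic (-(n : ℝ)) := by
    intro m n hmn
    apply Iic_subset_Iic.2
    have : (m : ℝ) ≤ n := by exact_mod_cast hmn
    linarith
  have h := tendsto_measure_iInter_atTop (μ := μ)
    (fun n : ℕ => (measurableSet_Iic (a := -(n : ℝ))).nullMeasurableSet) hm
    ⟨0, measure_ne_top _ _⟩
  have he : ⋂ n : ℕ, Iic (-(n : ℝ)) = ∅ := by
    ext x
    simp only [mem_iInter, mem_Iic, mem_empty_iff_false, iff_false, not_forall]
    obtain ⟨n, hn⟩ := exists_nat_gt (-x)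
    exact ⟨n, by linarith⟩
  rw [he, measure_empty] at h
  obtain ⟨n, hn⟩ := (h.eventually (gt_mem_nhds (show (0 : ℝ≥0∞) < 1 / 2 by simp))).exists
  exact ⟨-(n : ℝ), le_of_lt hn⟩

theorem medSet_bddAbove (μ : Measure ℝ) [IsProbabilityMeasure μ] :
    BddAbove {x : ℝ | μ (Iic x) ≤ 1 / 2} := by
  have h := tendsto_measure_Iic_atTop μ
  rw [measure_univ] at h
  have h2 : (1 / 2 : ℝ≥0∞) < 1 := by
    rw [one_div]; exact ENNReal.inv_lt_one.2 (by norm_num)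
  obtain ⟨M, hM⟩ := (h.eventually (lt_mem_nhds h2)).exists
  refine ⟨M, fun x hx => ?_⟩
  by_contra! hlt
  exact absurd ((measure_mono (Iic_subset_Iic.2 hlt.le)).trans hx) (not_le.2 hM)

theorem measure_Iio_med_le (μ : Measure ℝ) [IsProbabilityMeasure μ] :
    μ (Iio (med μ)) ≤ 1 / 2 := by
  have hU : Iio (med μ) = ⋃ n : ℕ, Iic (med μ - 1 / ((n : ℝ) + 1)) := by
    ext x
    simp only [mem_Iio, mem_iUnion, mem_Iic]
    refine ⟨fun h => ?_, fun ⟨n, h⟩ => ?_⟩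
    · obtain ⟨n, hn⟩ := exists_nat_one_div_lt (sub_pos.2 h)
      exact ⟨n, by linarith⟩
    · have : (0 : ℝ) < 1 / ((n : ℝ) + 1) := by positivity
      linarith
  have hm : Monotone fun n : ℕ => Iic (med μ - 1 / ((n : ℝ) + 1)) := by
    intro m n hmn
    apply Iic_subset_Iic.2
    have := Nat.one_div_le_one_div (α := ℝ) hmn
    linarith
  rw [hU, hm.measure_iUnion]
  refine iSup_le fun n => ?_
  have hlt : med μ - 1 / ((n : ℝ) + 1) < med μ := by
    have : (0 : ℝ) < 1 / ((n : ℝ) + 1) := by positivity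
    linarith
  obtain ⟨y, hy, hxy⟩ := exists_lt_of_lt_csSup (medSet_nonempty μ) hlt
  exact (measure_mono (Iic_subset_Iic.2 hxy.le)).trans hy

theorem le_measure_Iic_med (μ : Measure ℝ) [IsProbabilityMeasure μ] :
    1 / 2 ≤ μ (Iic (med μ)) := by
  have hI : Iic (med μ) = ⋂ n : ℕ, Iic (med μ + 1 / ((n : ℝ) + 1)) := by
    ext x
    simp only [mem_Iic, mem_iInter]
    refine ⟨fun h n => ?_, fun h => ?_⟩
    · have : (0 : ℝ) < 1 / ((n : ℝ) + 1) := by positivity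
      linarith
    · by_contra! hx
      obtain ⟨n, hn⟩ := exists_nat_one_div_lt (sub_pos.2 hx)
      have := h n
      linarith
  have hm : Antitone fun n : ℕ => Iic (med μ + 1 / ((n : ℝ) + 1)) := by
    intro m n hmn
    apply Iic_subset_Iic.2
    have := Nat.one_div_le_one_div (α := ℝ) hmn
    linarith
  rw [hI, hm.measure_iInter (fun n => measurableSet_Iic.nullMeasurableSet)
    ⟨0, measure_ne_top _ _⟩]
  refine le_iInf fun n => ?_
  by_contra! h
  have := le_csSup (medSet_bddAbove μ) (mem_ofPred_eq ▸ h.le : med μ + 1 / ((n : ℝ) + 1) ∈ _)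
  have h2 : (0 : ℝ) < 1 / ((n : ℝ) + 1) := by positivity
  change med μ + 1 / ((n : ℝ) + 1) ≤ med μ at this
  linarith

theorem massR_add_massL (μ : Measure ℝ) [IsProbabilityMeasure μ] :
    massR μ + massL μ = μ {med μ} := by
  have h : μ (Iic (med μ)) = μ (Iio (med μ)) + μ {med μ} := by
    rw [← measure_union (by simp) (measurableSet_singleton _), Iio_union_right]
  have h1 := measure_Iio_med_le μ
  have h2 := le_measure_Iic_med μ
  have hne : μ (Iio (med μ)) ≠ ⊤ := measure_ne_top _ _
  rw [massR, massL, tsub_add_tsub_cancel h2 h1, h, ENNReal.add_sub_cancel_left hne]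

open Classical in
/-- The fibre of the vector field at `B(μ)`: the probability measure
`(η δ₁ + (1/2 - μ(]-∞, B(μ)[)) δ₋₁) / μ({B(μ)})`. If `B(μ)` is not an atom of `μ`, its fibre is
irrelevant, and is taken to be `δ₁`. -/
def medFiber (μ : Measure ℝ) : Measure ℝ :=
  if μ {med μ} = 0 then Measure.dirac 1
  else (μ {med μ})⁻¹ • (massR μ • Measure.dirac 1 + massL μ • Measure.dirac (-1))

instance (μ : Measure ℝ) [IsProbabilityMeasure μ] : IsProbabilityMeasure (medFiber μ) := by
  unfold medFiber
  split_ifs with h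
  · infer_instance
  · refine ⟨?_⟩
    simp only [Measure.smul_apply, Measure.add_apply, measure_univ, smul_eq_mul, mul_one]
    rw [massR_add_massL, ENNReal.inv_mul_cancel h (measure_ne_top _ _)]

/-- The fibres `ν_x`: `δ₋₁` if `x < B(μ)`, `δ₁` if `x > B(μ)`, and `medFiber μ` if
`x = B(μ)`. -/
def medKernel (μ : Measure ℝ) : Kernel ℝ ℝ where
  toFun x :=
    if x < med μ then Measure.dirac (-1) else if med μ < x then Measure.dirac 1 else medFiber μ
  measurable' :=
    Measurable.ite measurableSet_Iio measurable_const
      (Measurable.ite measurableSet_Ioi measurable_const measurable_const)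

instance (μ : Measure ℝ) [IsProbabilityMeasure μ] : IsMarkovKernel (medKernel μ) := by
  refine ⟨fun x => ?_⟩
  change IsProbabilityMeasure
    (if x < med μ then Measure.dirac (-1) else if med μ < x then Measure.dirac 1 else medFiber μ)
  split_ifs <;> infer_instance

/-- The median-splitting vector field `V[μ] = μ ⊗ ν_x`. -/
def medianPVF : PVF where
  toFun μ := ⟨(μ : Measure ℝ) ⊗ₘ medKernel (μ : Measure ℝ), inferInstance⟩
  base μ := Measure.fst_compProd (μ : Measure ℝ) (medKernel (μ : Measure ℝ))

end MDE

end

open MDE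

/-!
In quantile coordinates `V[μ]` is the law of `(q(u), sgn(u - 1/2))`, where `q` is the quantile
function of `μ` and `u` is uniform on `]0, 1[`. Coupling `V[μ]` and `V[ν]` through the same `u`
projects to the monotone plan, which is optimal on the line, and couples equal velocities: hence
`𝒲(V[μ], V[ν]) = 0`. The flow moves `q(u)` to `q(u) + t sgn(u - 1/2)`; it is a nonexpansive
semigroup because this keeps the two halves of `μ` on their sides of the median. Since `±1` are grid
velocities, and a time step `1/N` moves the space grid into itself, the lattice scheme is exactly
the flow of the discretised datum, which is at distance at most `1/N²` from the datum.
-/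

noncomputable section

namespace MDE

/-! ### Lower and upper halves -/

/-- The lower half of a probability measure: its mass to the left of the median, together with the
part of the atom at the median that moves to the left. -/
def lowerHalf (μ : Measure ℝ) : Measure ℝ :=
  μ.restrict (Iio (med μ)) + massL μ • Measure.dirac (med μ)

/-- The upper half of a probability measure: its mass to the right of the median, together with the
part of the atom at the median that moves to the right. -/
def upperHalf (μ : Measure ℝ) : Measure ℝ :=
  μ.restrict (Ioi (med μ)) + massR μ • Measure.dirac (med μ)

/-- `α` and `β` split the probability measure `α + β` into two halves at `b`. The point `b` need not
be `med (α + β)`: any other median does. -/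
structure IsSplit (α β : Measure ℝ) (b : ℝ) : Prop where
  left_univ : α univ = 1 / 2
  right_univ : β univ = 1 / 2
  left_Ioi : α (Ioi b) = 0
  right_Iio : β (Iio b) = 0

namespace IsSplit

variable {α β α' β' : Measure ℝ} {b b' : ℝ}

theorem left_Iic (h : IsSplit α β b) (x : ℝ) : α (Iic x) = min ((α + β) (Iic x)) (1 / 2) := by
  rw [Measure.add_apply]
  rcases lt_or_ge x b with hx | hx
  · have hβ : β (Iic x) = 0 := measure_mono_null (Iic_subset_Iio.2 hx) h.right_Iio
    rw [hβ, add_zero, min_eq_left (h.left_univ ▸ measure_mono (subset_univ _))]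
  · have hα : α (Iic x) = 1 / 2 := by
      rw [← h.left_univ, measure_eq_measure_of_null_sdiff (subset_univ _)]
      rw [← compl_eq_univ_sdiff, compl_Iic]
      exact measure_mono_null (Ioi_subset_Ioi hx) h.left_Ioi
    rw [hα, min_eq_right le_self_add]

theorem isFiniteMeasure_left (h : IsSplit α β b) : IsFiniteMeasure α :=
  ⟨by rw [h.left_univ]; simp⟩

theorem left_unique (h : IsSplit α β b) (h' : IsSplit α' β' b') (hsum : α + β = α' + β') :
    α = α' := by
  have := h.isFiniteMeasure_left
  refine Measure.ext_of_Iic _ _ fun x => ?_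
  rw [h.left_Iic, h'.left_Iic, hsum]

theorem right_unique (h : IsSplit α β b) (h' : IsSplit α' β' b') (hsum : α + β = α' + β') :
    β = β' := by
  have := h.isFiniteMeasure_left
  rw [← h.left_unique h' hsum] at hsum
  exact (Measure.add_right_inj _ _ _).1 hsum

theorem map_sub_map_add (h : IsSplit α β b) {t : ℝ} (ht : 0 ≤ t) :
    IsSplit (α.map (· - t)) (β.map (· + t)) b where
  left_univ := by rw [Measure.map_apply (by fun_prop) .univ, preimage_univ, h.left_univ]
  right_univ := by rw [Measure.map_apply (by fun_prop) .univ, preimage_univ, h.right_univ]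
  left_Ioi := by
    rw [Measure.map_apply (by fun_prop) measurableSet_Ioi, preimage_sub_const_Ioi]
    exact measure_mono_null (Ioi_subset_Ioi (by linarith)) h.left_Ioi
  right_Iio := by
    rw [Measure.map_apply (by fun_prop) measurableSet_Iio, preimage_add_const_Iio]
    exact measure_mono_null (Iio_subset_Iio (by linarith)) h.right_Iio

end IsSplit

theorem eq_restrict_Iio_add_dirac_add_restrict_Ioi (μ : Measure ℝ) (b : ℝ) :
    μ = μ.restrict (Iio b) + μ {b} • Measure.dirac b + μ.restrict (Ioi b) := by
  conv_lhs => rw [← Measure.restrict_add_restrict_compl (μ := μ) (measurableSet_Iic (a := b))]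
  rw [compl_Iic, ← Iio_union_right, Measure.restrict_union (by simp) (measurableSet_singleton b),
    Measure.restrict_singleton]

section Halves

variable (μ : Measure ℝ) [IsProbabilityMeasure μ]

theorem lowerHalf_add_upperHalf : lowerHalf μ + upperHalf μ = μ := by
  conv_rhs =>
    rw [eq_restrict_Iio_add_dirac_add_restrict_Ioi μ (med μ), ← massR_add_massL, add_smul]
  rw [lowerHalf, upperHalf]
  abel

theorem isSplit_halves : IsSplit (lowerHalf μ) (upperHalf μ) (med μ) := by
  have hl : lowerHalf μ univ = 1 / 2 := by
    simp only [lowerHalf, Measure.add_apply, Measure.restrict_apply_univ, Measure.smul_apply,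
      measure_univ, smul_eq_mul, mul_one, massL]
    exact add_tsub_cancel_of_le (measure_Iio_med_le μ)
  refine ⟨hl, ?_, ?_, ?_⟩
  · have h : lowerHalf μ univ + upperHalf μ univ = 1 / 2 + 1 / 2 := by
      rw [← Measure.add_apply, lowerHalf_add_upperHalf, measure_univ, ENNReal.add_halves]
    rwa [hl, ENNReal.add_right_inj (by simp)] at h
  · simp [lowerHalf, Measure.restrict_apply, Ioi_inter_Iio]
  · simp [upperHalf, Measure.restrict_apply, Iio_inter_Ioi]

end Halves

theorem IsSplit.lowerHalf_eq {α β : Measure ℝ} {b : ℝ} (h : IsSplit α β b) :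
    lowerHalf (α + β) = α := by
  have : IsProbabilityMeasure (α + β) :=
    ⟨by rw [Measure.add_apply, h.left_univ, h.right_univ, ENNReal.add_halves]⟩
  exact (isSplit_halves _).left_unique h (lowerHalf_add_upperHalf _)

theorem IsSplit.upperHalf_eq {α β : Measure ℝ} {b : ℝ} (h : IsSplit α β b) :
    upperHalf (α + β) = β := by
  have : IsProbabilityMeasure (α + β) :=
    ⟨by rw [Measure.add_apply, h.left_univ, h.right_univ, ENNReal.add_halves]⟩
  exact (isSplit_halves _).right_unique h (lowerHalf_add_upperHalf _)

theorem compProd_eq_prod_of_ae_eq {X Y : Type*} [MeasurableSpace X] [MeasurableSpace Y]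
    {μ : Measure X} [SFinite μ] {κ : Kernel X Y} [IsSFiniteKernel κ] {ν : Measure Y} [SFinite ν]
    (h : ∀ᵐ x ∂μ, κ x = ν) : μ ⊗ₘ κ = μ.prod ν := by
  rw [← Measure.compProd_const]
  exact Measure.compProd_congr h

theorem measure_med_smul_medFiber (μ : Measure ℝ) [IsProbabilityMeasure μ] :
    μ {med μ} • medFiber μ = massL μ • Measure.dirac (-1) + massR μ • Measure.dirac 1 := by
  have hmass := massR_add_massL μ
  rw [medFiber, add_comm]
  split_ifs with h0
  · obtain ⟨hR, hL⟩ := add_eq_zero.1 (hmass.trans h0)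
    simp [h0, hR, hL]
  · rw [smul_smul, ENNReal.mul_inv_cancel h0 (measure_ne_top _ _), one_smul]

theorem smul_dirac_med_compProd_medKernel (μ : Measure ℝ) [IsProbabilityMeasure μ] :
    (μ {med μ} • Measure.dirac (med μ)) ⊗ₘ medKernel μ =
      massL μ • Measure.dirac (med μ, -1) + massR μ • Measure.dirac (med μ, 1) := by
  have hfib : Measure.dirac (med μ) ⊗ₘ medKernel μ = (Measure.dirac (med μ)).prod (medFiber μ) :=
    compProd_eq_prod_of_ae_eq (by simp [ae_dirac_eq, medKernel])
  rw [Measure.compProd_smul_left, hfib, ← Measure.prod_smul_right, measure_med_smul_medFiber,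
    Measure.prod_add, Measure.prod_smul_right, Measure.prod_smul_right, Measure.dirac_prod_dirac,
    Measure.dirac_prod_dirac]

theorem medianPVF_meas_eq_halves (μ : ProbabilityMeasure ℝ) :
    medianPVF.meas μ =
      (lowerHalf (μ : Measure ℝ)).map (·, -1) + (upperHalf (μ : Measure ℝ)).map (·, 1) := by
  obtain ⟨μ, hμ⟩ := μ
  change μ ⊗ₘ medKernel μ = (lowerHalf μ).map _ + (upperHalf μ).map _
  have hlow : μ.restrict (Iio (med μ)) ⊗ₘ medKernel μ =
      (μ.restrict (Iio (med μ))).map (·, -1) := by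
    rw [← Measure.prod_dirac]
    refine compProd_eq_prod_of_ae_eq ((ae_restrict_mem measurableSet_Iio).mono fun x hx => ?_)
    exact if_pos hx
  have hupp : μ.restrict (Ioi (med μ)) ⊗ₘ medKernel μ =
      (μ.restrict (Ioi (med μ))).map (·, 1) := by
    rw [← Measure.prod_dirac]
    refine compProd_eq_prod_of_ae_eq ((ae_restrict_mem measurableSet_Ioi).mono fun x hx => ?_)
    exact (if_neg (not_lt.2 (mem_Ioi.1 hx).le)).trans (if_pos hx)
  calc μ ⊗ₘ medKernel μ
    _ = (μ.restrict (Iio (med μ)) + μ {med μ} • Measure.dirac (med μ) + μ.restrict (Ioi (med μ)))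
          ⊗ₘ medKernel μ :=
      congrArg (· ⊗ₘ medKernel μ) (eq_restrict_Iio_add_dirac_add_restrict_Ioi μ (med μ))
    _ = (μ.restrict (Iio (med μ))).map (·, -1) +
          (massL μ • Measure.dirac (med μ, -1) + massR μ • Measure.dirac (med μ, 1)) +
          (μ.restrict (Ioi (med μ))).map (·, 1) := by
      rw [Measure.compProd_add_left, Measure.compProd_add_left, hlow, hupp,
        smul_dirac_med_compProd_medKernel]
    _ = (lowerHalf μ).map (·, -1) + (upperHalf μ).map (·, 1) := by
      have hm (v : ℝ) : Measurable fun x : ℝ => (x, v) := by fun_prop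
      rw [lowerHalf, upperHalf, Measure.map_add _ _ (hm _), Measure.map_add _ _ (hm _),
        Measure.map_smul, Measure.map_smul, Measure.map_dirac' (hm _), Measure.map_dirac' (hm _)]
      abel

theorem IsSplit.medianPVF_meas_eq {α β : Measure ℝ} {b : ℝ} (h : IsSplit α β b)
    {μ : ProbabilityMeasure ℝ} (hμ : (μ : Measure ℝ) = α + β) :
    medianPVF.meas μ = α.map (·, -1) + β.map (·, 1) := by
  rw [medianPVF_meas_eq_halves, hμ, h.lowerHalf_eq, h.upperHalf_eq]

/-! ### The spreading flow -/

/-- The measure obtained from a probability measure `μ` by moving its lower half to the left and its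
upper half to the right by the distance `t`: the position at time `t` of the solution of
`μ' = V[μ]` for the median-splitting vector field `V`. -/
def spread (μ : Measure ℝ) (t : ℝ) : Measure ℝ :=
  (lowerHalf μ).map (· - t) + (upperHalf μ).map (· + t)

theorem IsSplit.spread_eq {α β : Measure ℝ} {b : ℝ} (h : IsSplit α β b) (t : ℝ) :
    spread (α + β) t = α.map (· - t) + β.map (· + t) := by
  rw [spread, h.lowerHalf_eq, h.upperHalf_eq]

theorem spread_apply (μ : Measure ℝ) (t : ℝ) {A : Set ℝ} (hA : MeasurableSet A) :
    spread μ t A =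
      μ ((fun x => x + t) '' (A ∩ Iio (med μ - t))) +
        μ ((fun x => x - t) '' (A ∩ Ioi (med μ + t))) +
        massR μ * Measure.dirac (med μ + t) A + massL μ * Measure.dirac (med μ - t) A := by
  have hA₁ : MeasurableSet ((· - t) ⁻¹' A) := hA.preimage (by fun_prop)
  have hA₂ : MeasurableSet ((· + t) ⁻¹' A) := hA.preimage (by fun_prop)
  have hleft : (· - t) ⁻¹' A ∩ Iio (med μ) = (fun x => x + t) '' (A ∩ Iio (med μ - t)) := by
    simp [image_add_right, ← sub_eq_add_neg, preimage_inter]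
  have hright : (· + t) ⁻¹' A ∩ Ioi (med μ) = (fun x => x - t) '' (A ∩ Ioi (med μ + t)) := by
    simp [sub_eq_add_neg, image_add_right, preimage_inter]
  rw [spread, lowerHalf, upperHalf, Measure.map_add _ _ (by fun_prop),
    Measure.map_add _ _ (by fun_prop), Measure.map_smul, Measure.map_smul,
    Measure.map_dirac' (by fun_prop), Measure.map_dirac' (by fun_prop), ← hleft, ← hright]
  simp only [Measure.add_apply, Measure.smul_apply, smul_eq_mul,
    Measure.map_apply (measurable_sub_const t) hA, Measure.map_apply (measurable_add_const t) hA,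
    Measure.restrict_apply hA₁, Measure.restrict_apply hA₂]
  ac_rfl

section Probability

variable (μ : Measure ℝ) [IsProbabilityMeasure μ]

instance isProbabilityMeasure_spread (t : ℝ) : IsProbabilityMeasure (spread μ t) := by
  refine ⟨?_⟩
  rw [spread, Measure.add_apply, Measure.map_apply (by fun_prop) .univ,
    Measure.map_apply (by fun_prop) .univ, preimage_univ, preimage_univ, ← Measure.add_apply,
    lowerHalf_add_upperHalf, measure_univ]

theorem spread_zero : spread μ 0 = μ := by
  simp only [spread, sub_zero, add_zero, Measure.map_id', lowerHalf_add_upperHalf]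

theorem spread_spread {s : ℝ} (hs : 0 ≤ s) (t : ℝ) :
    spread (spread μ s) t = spread μ (t + s) := by
  rw [spread.eq_1 μ s, ((isSplit_halves μ).map_sub_map_add hs).spread_eq,
    Measure.map_map (by fun_prop) (by fun_prop), Measure.map_map (by fun_prop) (by fun_prop),
    spread]
  simp only [Function.comp_def, sub_sub, add_assoc, add_comm s t]

theorem ae_spread {p : ℝ → Prop} (hp : MeasurableSet {x | p x}) {t : ℝ}
    (h : ∀ᵐ x ∂μ, p (x - t) ∧ p (x + t)) : ∀ᵐ x ∂(spread μ t), p x := by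
  rw [← lowerHalf_add_upperHalf μ, ae_add_measure_iff] at h
  rw [spread, ae_add_measure_iff, ae_map_iff (by fun_prop) hp, ae_map_iff (by fun_prop) hp]
  exact ⟨h.1.mono fun _ hx => hx.1, h.2.mono fun _ hx => hx.2⟩

end Probability

theorem half_smul_add_half_smul {X : Type*} [MeasurableSpace X] (μ : Measure X) :
    (1 / 2 : ℝ≥0∞) • μ + (1 / 2 : ℝ≥0∞) • μ = μ := by
  rw [← add_smul, ENNReal.add_halves, one_smul]

theorem isSplit_dirac (x : ℝ) :
    IsSplit ((1 / 2 : ℝ≥0∞) • Measure.dirac x) ((1 / 2 : ℝ≥0∞) • Measure.dirac x) x :=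
  ⟨by simp, by simp, by simp, by simp⟩

theorem spread_dirac (x t : ℝ) :
    spread (Measure.dirac x) t =
      (1 / 2 : ℝ≥0∞) • Measure.dirac (x + t) + (1 / 2 : ℝ≥0∞) • Measure.dirac (x - t) := by
  rw [← half_smul_add_half_smul (Measure.dirac x), (isSplit_dirac x).spread_eq, Measure.map_smul,
    Measure.map_smul, Measure.map_dirac' (by fun_prop), Measure.map_dirac' (by fun_prop), add_comm]

theorem restrict_Icc_add_restrict_Icc (μ : Measure ℝ) [NullSingletonClass μ] {a b c : ℝ}
    (hab : a ≤ b) (hbc : b ≤ c) :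
    μ.restrict (Icc a b) + μ.restrict (Icc b c) = μ.restrict (Icc a c) := by
  rw [← Measure.restrict_congr_set (Ioc_ae_eq_Icc (a := b) (b := c)),
    ← Measure.restrict_union (disjoint_left.2 fun x hx hx' => not_lt.2 hx.2 hx'.1)
      measurableSet_Ioc, Icc_union_Ioc_eq_Icc hab hbc]

theorem isSplit_uniform {a b : ℝ} (hab : a < b) :
    IsSplit ((ENNReal.ofReal (b - a))⁻¹ • volume.restrict (Icc a ((a + b) / 2)))
      ((ENNReal.ofReal (b - a))⁻¹ • volume.restrict (Icc ((a + b) / 2) b)) ((a + b) / 2) := by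
  have hhalf : (ENNReal.ofReal (b - a))⁻¹ * ENNReal.ofReal ((b - a) / 2) = 1 / 2 := by
    rw [ENNReal.ofReal_div_of_pos (by norm_num), ← mul_div_assoc,
      ENNReal.inv_mul_cancel (by simpa using hab) (by simp)]
    simp
  refine ⟨?_, ?_, ?_, ?_⟩
  · rw [Measure.smul_apply, Measure.restrict_apply_univ, Real.volume_Icc, smul_eq_mul, ← hhalf]
    ring_nf
  · rw [Measure.smul_apply, Measure.restrict_apply_univ, Real.volume_Icc, smul_eq_mul, ← hhalf]
    ring_nf
  · have hdisj : Ioi ((a + b) / 2) ∩ Icc a ((a + b) / 2) = ∅ :=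
      eq_empty_of_forall_notMem fun x hx => not_le.2 hx.1 hx.2.2
    rw [Measure.smul_apply, Measure.restrict_apply measurableSet_Ioi, hdisj, measure_empty,
      smul_zero]
  · have hdisj : Iio ((a + b) / 2) ∩ Icc ((a + b) / 2) b = ∅ :=
      eq_empty_of_forall_notMem fun x hx => not_le.2 hx.1 hx.2.1
    rw [Measure.smul_apply, Measure.restrict_apply measurableSet_Iio, hdisj, measure_empty,
      smul_zero]

theorem spread_uniform {a b : ℝ} (hab : a < b) (t : ℝ) :
    spread ((ENNReal.ofReal (b - a))⁻¹ • volume.restrict (Icc a b)) t =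
      (ENNReal.ofReal (b - a))⁻¹ • volume.restrict (Icc (a - t) ((a + b) / 2 - t)) +
        (ENNReal.ofReal (b - a))⁻¹ • volume.restrict (Icc ((a + b) / 2 + t) (b + t)) := by
  have hleft := (measurePreserving_sub_right volume t).restrict_preimage
    (measurableSet_Icc (a := a - t) (b := (a + b) / 2 - t))
  have hright := (measurePreserving_add_right volume t).restrict_preimage
    (measurableSet_Icc (a := (a + b) / 2 + t) (b := b + t))
  rw [preimage_sub_const_Icc, sub_add_cancel, sub_add_cancel] at hleft
  rw [preimage_add_const_Icc, add_sub_cancel_right, add_sub_cancel_right] at hright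
  rw [← restrict_Icc_add_restrict_Icc volume (b := (a + b) / 2) (by linarith) (by linarith),
    smul_add, (isSplit_uniform hab).spread_eq, Measure.map_smul, Measure.map_smul, hleft.map_eq,
    hright.map_eq]

theorem support_subset_iff_ae {X : Type*} [TopologicalSpace X] [HereditarilyLindelofSpace X]
    [MeasurableSpace X] {μ : Measure X} {K : Set X} (hK : IsClosed K) :
    μ.support ⊆ K ↔ ∀ᵐ x ∂μ, x ∈ K :=
  ⟨fun h => mem_of_superset Measure.support_mem_ae h, Measure.support_subset_of_isClosed hK⟩

theorem support_spread_subset (μ : Measure ℝ) [IsProbabilityMeasure μ] {R : ℝ}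
    (h : μ.support ⊆ Metric.closedBall 0 R) (t : ℝ) :
    (spread μ t).support ⊆ Metric.closedBall 0 (R + |t|) := by
  rw [support_subset_iff_ae Metric.isClosed_closedBall] at h ⊢
  refine ae_spread μ (p := (· ∈ Metric.closedBall 0 (R + |t|)))
    Metric.isClosed_closedBall.measurableSet (h.mono fun x hx => ?_)
  simp only [mem_closedBall_zero_iff, Real.norm_eq_abs] at hx ⊢
  exact ⟨(abs_sub x t).trans (by linarith), (abs_add_le x t).trans (by linarith)⟩

theorem Pc.exists_supp_subset (μ : Pc) : ∃ R : ℝ, μ.supp ⊆ Metric.closedBall 0 R :=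
  μ.2.isBounded.subset_closedBall 0

theorem Pc.ext_coe {μ ν : Pc} (h : (μ.1 : Measure ℝ) = ν.1) : μ = ν :=
  Subtype.ext (Subtype.ext h)

/-- The flow `μ ↦ spread μ t` on `𝒫_c(ℝ)`, the semigroup of the median-splitting vector field. -/
def medianFlow (t : ℝ) (μ : Pc) : Pc :=
  ⟨⟨spread (μ.1 : Measure ℝ) t, inferInstance⟩, by
    obtain ⟨R, hR⟩ := μ.exists_supp_subset
    exact (isCompact_closedBall (0 : ℝ) (R + |t|)).of_isClosed_subset Measure.isClosed_support
      (support_spread_subset _ hR t)⟩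

theorem coe_medianFlow (t : ℝ) (μ : Pc) :
    ((medianFlow t μ).1 : Measure ℝ) = spread (μ.1 : Measure ℝ) t := rfl

/-! ### The vector field along the flow -/

instance (V : PVF) (μ : ProbabilityMeasure ℝ) : IsProbabilityMeasure (V.meas μ) :=
  inferInstanceAs (IsProbabilityMeasure (V.toFun μ : Measure (ℝ × ℝ)))

theorem ae_medianPVF_meas (μ : ProbabilityMeasure ℝ) :
    ∀ᵐ p ∂(medianPVF.meas μ), p.2 = -1 ∨ p.2 = 1 := by
  have hm : MeasurableSet {p : ℝ × ℝ | p.2 = -1 ∨ p.2 = 1} :=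
    (measurableSet_eq_fun measurable_snd measurable_const).union
      (measurableSet_eq_fun measurable_snd measurable_const)
  rw [medianPVF_meas_eq_halves, ae_add_measure_iff, ae_map_iff (by fun_prop) hm,
    ae_map_iff (by fun_prop) hm]
  simp

theorem ae_abs_snd_medianPVF_meas (μ : ProbabilityMeasure ℝ) :
    ∀ᵐ p ∂(medianPVF.meas μ), |p.2| = 1 :=
  (ae_medianPVF_meas μ).mono fun _ hp => by rcases hp with h | h <;> simp [h]

theorem map_medianPVF_meas_eq_spread (μ : ProbabilityMeasure ℝ) (t : ℝ) :
    (medianPVF.meas μ).map (fun p => p.1 + t * p.2) = spread (μ : Measure ℝ) t := by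
  rw [medianPVF_meas_eq_halves, Measure.map_add _ _ (by fun_prop),
    Measure.map_map (by fun_prop) (by fun_prop), Measure.map_map (by fun_prop) (by fun_prop),
    spread]
  simp only [Function.comp_def, mul_neg, mul_one, ← sub_eq_add_neg]

theorem medianPVF_meas_spread {μ ν : ProbabilityMeasure ℝ} {t : ℝ} (ht : 0 ≤ t)
    (hν : (ν : Measure ℝ) = spread (μ : Measure ℝ) t) :
    medianPVF.meas ν = (medianPVF.meas μ).map (fun p => (p.1 + t * p.2, p.2)) := by
  rw [((isSplit_halves (μ : Measure ℝ)).map_sub_map_add ht).medianPVF_meas_eq hν,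
    medianPVF_meas_eq_halves, Measure.map_add _ _ (by fun_prop)]
  repeat rw [Measure.map_map (by fun_prop) (by fun_prop)]
  simp only [Function.comp_def, mul_neg, mul_one, ← sub_eq_add_neg]

theorem supportSublinear_one : SupportSublinear medianPVF 1 := by
  intro μ p hp
  have hclosed : IsClosed {p : ℝ × ℝ | |p.2| = 1} := isClosed_eq (by fun_prop) continuous_const
  have hspeed : |p.2| = 1 :=
    (support_subset_iff_ae hclosed).2 (ae_abs_snd_medianPVF_meas μ.1) hp
  have hsup : 0 ≤ sSup ((fun x : ℝ => |x|) '' μ.supp) :=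
    Real.sSup_nonneg (forall_mem_image.2 fun x _ => abs_nonneg x)
  linarith

theorem support_dirac_subset (x : ℝ) : (Measure.dirac x).support ⊆ {x} :=
  (support_subset_iff_ae isClosed_singleton).2 (by simp [ae_dirac_eq])

theorem mem_support_of_measure_singleton_ne_zero {X : Type*} [TopologicalSpace X]
    [MeasurableSpace X] {μ : Measure X} {x : X} (h : μ {x} ≠ 0) : x ∈ μ.support :=
  (Measure.mem_support_iff_forall x).2 fun _ hU =>
    h.bot_lt.trans_le (measure_mono (singleton_subset_iff.2 (mem_of_mem_nhds hU)))

theorem one_le_of_supportSublinear {C : ℝ} (h : SupportSublinear medianPVF C) : 1 ≤ C := by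
  let δ : Pc := ⟨⟨Measure.dirac 0, inferInstance⟩,
    isCompact_singleton.of_isClosed_subset Measure.isClosed_support (support_dirac_subset 0)⟩
  have hmem : ((0 : ℝ), (1 : ℝ)) ∈ (medianPVF.meas δ.1).support := by
    refine mem_support_of_measure_singleton_ne_zero ?_
    rw [(isSplit_dirac 0).medianPVF_meas_eq (μ := δ.1) (half_smul_add_half_smul _).symm,
      Measure.map_smul, Measure.map_smul, Measure.map_dirac' (by fun_prop),
      Measure.map_dirac' (by fun_prop)]
    simp
  have hsup : sSup ((fun x : ℝ => |x|) '' δ.supp) ≤ 0 := by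
    refine Real.sSup_nonpos (forall_mem_image.2 fun x hx => ?_)
    simp [show x = 0 from support_dirac_subset 0 hx]
  have hC : 1 ≤ C * (1 + sSup ((fun x : ℝ => |x|) '' δ.supp)) := by simpa using h δ _ hmem
  have hsup' : sSup ((fun x : ℝ => |x|) '' δ.supp) = 0 :=
    hsup.antisymm (Real.sSup_nonneg (forall_mem_image.2 fun x _ => abs_nonneg x))
  simpa [hsup'] using hC

/-! ### Free transport -/

section FreeTransport

variable {Λ : Measure (ℝ × ℝ)} {f : ℝ → ℝ}

theorem exists_bound_deriv_mul (hf : ContDiff ℝ 1 f) (hfc : HasCompactSupport f) :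
    ∃ K : ℝ, 0 ≤ K ∧ ∀ x v : ℝ, ‖deriv f x * v‖ ≤ K * ‖v‖ := by
  obtain ⟨K, hK⟩ := hfc.deriv.exists_bound_of_continuous (hf.continuous_deriv le_rfl)
  refine ⟨K, (norm_nonneg _).trans (hK 0), fun x v => ?_⟩
  rw [norm_mul]
  gcongr
  exact hK x

theorem aestronglyMeasurable_deriv_freeTransport (hf : ContDiff ℝ 1 f) (t : ℝ) :
    AEStronglyMeasurable (fun p : ℝ × ℝ => deriv f (p.1 + t * p.2) * p.2) Λ :=
  (((hf.continuous_deriv le_rfl).comp (by fun_prop)).mul continuous_snd).aestronglyMeasurable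

theorem hasDerivAt_integral_freeTransport [IsFiniteMeasure Λ] (hf : ContDiff ℝ 1 f)
    (hfc : HasCompactSupport f) (hΛ : Integrable Prod.snd Λ) (t : ℝ) :
    HasDerivAt (fun t => ∫ p, f (p.1 + t * p.2) ∂Λ)
      (∫ p, deriv f (p.1 + t * p.2) * p.2 ∂Λ) t := by
  obtain ⟨K, -, hK⟩ := exists_bound_deriv_mul hf hfc
  obtain ⟨M, hM⟩ := hfc.exists_bound_of_continuous hf.continuous
  have hmeas (t : ℝ) : AEStronglyMeasurable (fun p : ℝ × ℝ => f (p.1 + t * p.2)) Λ :=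
    (hf.continuous.comp (by fun_prop)).aestronglyMeasurable
  refine (hasDerivAt_integral_of_dominated_loc_of_deriv_le
    (F := fun t (p : ℝ × ℝ) => f (p.1 + t * p.2))
    (F' := fun t p => deriv f (p.1 + t * p.2) * p.2) univ_mem (.of_forall hmeas)
    (Integrable.of_bound (hmeas t) M (.of_forall fun p => hM _))
    (aestronglyMeasurable_deriv_freeTransport hf t)
    (.of_forall fun p t _ => hK (p.1 + t * p.2) p.2) (hΛ.norm.const_mul K)
    (.of_forall fun p t _ => ?_)).2
  have hline : HasDerivAt (fun t : ℝ => p.1 + t * p.2) p.2 t := by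
    simpa using ((hasDerivAt_id t).mul_const p.2).const_add p.1
  exact ((hf.differentiable one_ne_zero) _).hasDerivAt.comp t hline

theorem continuous_integral_deriv_freeTransport (hf : ContDiff ℝ 1 f) (hfc : HasCompactSupport f)
    (hΛ : Integrable Prod.snd Λ) :
    Continuous fun t => ∫ p, deriv f (p.1 + t * p.2) * p.2 ∂Λ := by
  obtain ⟨K, -, hK⟩ := exists_bound_deriv_mul hf hfc
  refine continuous_of_dominated (aestronglyMeasurable_deriv_freeTransport hf)
    (fun t => .of_forall fun p => hK (p.1 + t * p.2) p.2) (hΛ.norm.const_mul K)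
    (.of_forall fun p => ?_)
  exact ((hf.continuous_deriv le_rfl).comp (by fun_prop)).mul continuous_const

theorem exists_lipschitzWith_integral_freeTransport [IsFiniteMeasure Λ] (hf : ContDiff ℝ 1 f)
    (hfc : HasCompactSupport f) (hΛ : Integrable Prod.snd Λ) :
    ∃ L, LipschitzWith L fun t => ∫ p, f (p.1 + t * p.2) ∂Λ := by
  obtain ⟨K, hK0, hK⟩ := exists_bound_deriv_mul hf hfc
  have hder := hasDerivAt_integral_freeTransport hf hfc hΛ
  have hL : 0 ≤ ∫ p, K * ‖p.2‖ ∂Λ := integral_nonneg fun p => by positivity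
  refine ⟨Real.toNNReal (∫ p, K * ‖p.2‖ ∂Λ),
    lipschitzWith_of_nnnorm_deriv_le (fun t => (hder t).differentiableAt) fun t => ?_⟩
  rw [(hder t).deriv, ← NNReal.coe_le_coe, coe_nnnorm, Real.coe_toNNReal _ hL]
  exact norm_integral_le_of_norm_le (hΛ.norm.const_mul K)
    (.of_forall fun p => hK (p.1 + t * p.2) p.2)

theorem isSolution_of_freeTransport {V : PVF} {T : ℝ} {μ₀ : Pc} {ρ : ℝ → Pc}
    (hint : Integrable Prod.snd (V.meas μ₀.1))
    (hbase : ∀ t, ((ρ t).1 : Measure ℝ) = (V.meas μ₀.1).map fun p => p.1 + t * p.2)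
    (hV : ∀ t ∈ Icc 0 T,
      V.meas (ρ t).1 = (V.meas μ₀.1).map fun p => (p.1 + t * p.2, p.2)) :
    IsSolution V T μ₀ ρ := by
  have hzero : ((ρ 0).1 : Measure ℝ) = μ₀.1 := by
    simp only [hbase, zero_mul, add_zero]
    exact V.base μ₀.1
  refine ⟨Pc.ext_coe hzero, fun f hf₀ hfc => ?_⟩
  have hf : ContDiff ℝ 1 f := hf₀.of_le (by simp)
  have hmeas (t : ℝ) :
      AEStronglyMeasurable (fun p : ℝ × ℝ => deriv f p.1 * p.2) (V.meas (ρ t).1) := by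
    simpa using aestronglyMeasurable_deriv_freeTransport (Λ := V.meas (ρ t).1) hf 0
  have hspeed : ∀ t ∈ Icc 0 T, ∫ p, deriv f p.1 * p.2 ∂(V.meas (ρ t).1) =
      ∫ p, deriv f (p.1 + t * p.2) * p.2 ∂(V.meas μ₀.1) := fun t ht => by
    rw [hV t ht, integral_map (by fun_prop) (hV t ht ▸ hmeas t)]
  have hvalue (t : ℝ) : ∫ x, f x ∂((ρ t).1 : Measure ℝ) =
      ∫ p, f (p.1 + t * p.2) ∂(V.meas μ₀.1) := by
    rw [hbase, integral_map (by fun_prop) hf.continuous.aestronglyMeasurable]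
  simp only [hvalue]
  refine ⟨ae_restrict_of_forall_mem measurableSet_Icc fun t ht => ?_, ?_, ?_,
    ae_restrict_of_forall_mem measurableSet_Icc fun t ht => ?_⟩
  · obtain ⟨K, -, hK⟩ := exists_bound_deriv_mul hf hfc
    rw [hV t ht, integrable_map_measure (hV t ht ▸ hmeas t) (by fun_prop)]
    exact (hint.norm.const_mul K).mono' (aestronglyMeasurable_deriv_freeTransport hf t)
      (.of_forall fun p => hK _ _)
  · exact (continuous_integral_deriv_freeTransport hf hfc hint).integrableOn_Icc.congr_fun
      (fun t ht => (hspeed t ht).symm) measurableSet_Icc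
  · obtain ⟨L, hL⟩ := exists_lipschitzWith_integral_freeTransport hf hfc hint
    exact hL.lipschitzOnWith.absolutelyContinuousOnInterval
  · rw [hspeed t ht]
    exact hasDerivAt_integral_freeTransport hf hfc hint t

end FreeTransport

theorem isSolution_medianFlow (T : ℝ) (μ : Pc) :
    IsSolution medianPVF T μ (fun t => medianFlow t μ) :=
  isSolution_of_freeTransport
    (Integrable.of_bound (by fun_prop) 1
      ((ae_abs_snd_medianPVF_meas μ.1).mono fun _ hp => hp.le))
    (fun t => (map_medianPVF_meas_eq_spread μ.1 t).symm)
    (fun t ht => medianPVF_meas_spread ht.1 rfl)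

/-! ### Optimal transport on the line -/

section Plans

variable {X Ω : Type*} [MeasurableSpace X] [MeasurableSpace Ω] {μ ν : Measure X}
  {τ : Measure (X × X)}

theorem IsPlan.isFiniteMeasure [IsFiniteMeasure μ] (h : IsPlan τ μ ν) : IsFiniteMeasure τ := by
  have : IsFiniteMeasure (τ.map Prod.fst) := h.1 ▸ ‹_›
  exact Measure.isFiniteMeasure_of_map measurable_fst.aemeasurable

theorem isPlan_map (P : Measure Ω) {f g : Ω → X} (hf : Measurable f) (hg : Measurable g) :
    IsPlan (P.map fun a => (f a, g a)) (P.map f) (P.map g) :=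
  ⟨Measure.map_map measurable_fst (hf.prodMk hg), Measure.map_map measurable_snd (hf.prodMk hg)⟩

variable [PseudoEMetricSpace X]

theorem W_le_cost (h : IsPlan τ μ ν) : W μ ν ≤ cost τ := iInf₂_le τ h

theorem W_map_le (P : Measure Ω) {f g : Ω → X} (hf : Measurable f) (hg : Measurable g) :
    W (P.map f) (P.map g) ≤ ∫⁻ a, edist (f a) (g a) ∂P :=
  (W_le_cost (isPlan_map P hf hg)).trans (lintegral_map_le _ _)

end Plans

/-- The pairs separated by the level `z`, of the form `p.1 ≤ z < p.2` or `p.2 ≤ z < p.1`. The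
distance of two points is the length of the set of levels which separate them, and this turns the
cost of a plan into an integral over the levels. -/
def separated (z : ℝ) : Set (ℝ × ℝ) := {p | (p.1 ≤ z ∧ z < p.2) ∨ (p.2 ≤ z ∧ z < p.1)}

theorem measurableSet_setOf_mem_separated :
    MeasurableSet {q : (ℝ × ℝ) × ℝ | q.1 ∈ separated q.2} := by
  have hx : Measurable fun q : (ℝ × ℝ) × ℝ => q.1.1 := by fun_prop
  have hy : Measurable fun q : (ℝ × ℝ) × ℝ => q.1.2 := by fun_prop
  exact ((measurableSet_le hx measurable_snd).inter (measurableSet_lt measurable_snd hy)).union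
    ((measurableSet_le hy measurable_snd).inter (measurableSet_lt measurable_snd hx))

theorem measurableSet_separated (z : ℝ) : MeasurableSet (separated z) :=
  measurableSet_setOf_mem_separated.preimage (f := fun p => (p, z)) (by fun_prop)

theorem volume_setOf_mem_separated (p : ℝ × ℝ) :
    volume {z : ℝ | p ∈ separated z} = edist p.1 p.2 := by
  have hIco : {z : ℝ | p ∈ separated z} = Ico (min p.1 p.2) (max p.1 p.2) := by
    ext z
    simp only [separated, mem_ofPred_eq, mem_Ico, min_le_iff, lt_max_iff]
    grind
  rw [hIco, Real.volume_Ico, max_sub_min_eq_abs, edist_dist, Real.dist_eq, abs_sub_comm]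

theorem cost_eq_lintegral_separated (τ : Measure (ℝ × ℝ)) [SFinite τ] :
    cost τ = ∫⁻ z, τ (separated z) := calc
  cost τ = ∫⁻ p, volume {z : ℝ | p ∈ separated z} ∂τ := by
    simp only [cost, volume_setOf_mem_separated]
  _ = (τ.prod volume) {q | q.1 ∈ separated q.2} :=
    (Measure.prod_apply measurableSet_setOf_mem_separated).symm
  _ = ∫⁻ z, τ (separated z) := Measure.prod_apply_symm measurableSet_setOf_mem_separated

section Levels

variable {τ : Measure (ℝ × ℝ)} {μ ν : Measure ℝ} [IsProbabilityMeasure μ]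
  [IsProbabilityMeasure ν]

theorem edist_cdf_le_measure_separated (h : IsPlan τ μ ν) (z : ℝ) :
    edist (cdf μ z) (cdf ν z) ≤ τ (separated z) := by
  have := h.isFiniteMeasure
  have hμ : cdf μ z = τ.real {p | p.1 ≤ z} := by
    rw [cdf_eq_real, ← h.1, map_measureReal_apply measurable_fst measurableSet_Iic]
    rfl
  have hν : cdf ν z = τ.real {p | p.2 ≤ z} := by
    rw [cdf_eq_real, ← h.2, map_measureReal_apply measurable_snd measurableSet_Iic]
    rfl
  rw [edist_dist, Real.dist_eq, ENNReal.ofReal_le_iff_le_toReal (measure_ne_top _ _), hμ, hν,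
    ← Measure.real, abs_sub_le_iff, sub_le_iff_le_add, sub_le_iff_le_add]
  constructor <;>
  · refine (measureReal_mono fun p hp => ?_).trans (measureReal_union_le _ _)
    simp only [separated, mem_ofPred_eq, mem_union] at hp ⊢
    grind

theorem lintegral_edist_cdf_le_cost (h : IsPlan τ μ ν) :
    ∫⁻ z, edist (cdf μ z) (cdf ν z) ≤ cost τ := by
  have := h.isFiniteMeasure
  rw [cost_eq_lintegral_separated]
  exact lintegral_mono fun z => edist_cdf_le_measure_separated h z

end Levels

attribute [local instance] Measure.Subtype.measureSpace

section Quantile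

/-- The quantile function of `μ`, the generalised inverse of its distribution function. It is
defined on the open interval, where the infimum is a genuine one: of a nonempty set which is
bounded below. -/
def quantile (μ : Measure ℝ) (u : Ioo (0 : ℝ) 1) : ℝ := sInf {x | (u : ℝ) ≤ cdf μ x}

instance : IsProbabilityMeasure (volume : Measure (Ioo (0 : ℝ) 1)) :=
  ⟨by simp [Measure.Subtype.volume_univ nullMeasurableSet_Ioo]⟩

theorem quantile_le_iff {μ : Measure ℝ} {u : Ioo (0 : ℝ) 1} {x : ℝ} :
    quantile μ u ≤ x ↔ (u : ℝ) ≤ cdf μ x := by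
  have hbdd : BddBelow {x | (u : ℝ) ≤ cdf μ x} := by
    obtain ⟨m, hm⟩ := ((tendsto_cdf_atBot μ).eventually_lt_const u.2.1).exists
    exact ⟨m, fun y hy => ((monotone_cdf μ).reflect_lt (hm.trans_le hy)).le⟩
  have hne : {x | (u : ℝ) ≤ cdf μ x}.Nonempty :=
    ((tendsto_cdf_atTop μ).eventually_const_le u.2.2).exists
  refine ⟨fun h => ?_, fun h => csInf_le hbdd h⟩
  have hright : Tendsto (cdf μ) (𝓝[>] x) (𝓝 (cdf μ x)) :=
    ((cdf μ).right_continuous x).mono_left (nhdsWithin_mono _ Ioi_subset_Ici_self)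
  refine ge_of_tendsto hright (eventually_mem_nhdsWithin.mono fun y hy => ?_)
  obtain ⟨w, hw, hwy⟩ := exists_lt_of_csInf_lt hne (h.trans_lt hy)
  exact hw.trans (monotone_cdf μ hwy.le)

variable (μ ν : Measure ℝ)

theorem monotone_quantile : Monotone (quantile μ) := fun _ _ huv =>
  quantile_le_iff.2 (le_trans (Subtype.coe_le_coe.2 huv) (quantile_le_iff.1 le_rfl))

@[fun_prop]
theorem measurable_quantile : Measurable (quantile μ) := (monotone_quantile μ).measurable

theorem map_quantile [IsProbabilityMeasure μ] : volume.map (quantile μ) = μ := by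
  have := Measure.isProbabilityMeasure_map (μ := volume) (measurable_quantile μ).aemeasurable
  refine Measure.ext_of_Iic _ _ fun x => ?_
  have hpre : quantile μ ⁻¹' Iic x = (↑) ⁻¹' Iic (cdf μ x) := ext fun _ => quantile_le_iff
  rw [Measure.map_apply (measurable_quantile μ) measurableSet_Iic, hpre,
    volume_preimage_coe nullMeasurableSet_Ioo measurableSet_Iic, measure_congr
      ((ae_eq_refl _).inter Ioo_ae_eq_Ioc), inter_comm, Ioc_inter_Iic, Real.volume_Ioc,
    min_eq_right (cdf_le_one μ x), sub_zero, ofReal_cdf]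

/-- The monotone rearrangement plan from `μ` to `ν`, which couples the quantiles of equal order. -/
def monotonePlan : Measure (ℝ × ℝ) := volume.map fun u => (quantile μ u, quantile ν u)

theorem measure_monotonePlan_separated_le (z : ℝ) :
    monotonePlan μ ν (separated z) ≤ edist (cdf μ z) (cdf ν z) := calc
  monotonePlan μ ν (separated z)
      ≤ volume ((↑) ⁻¹' uIoc (cdf μ z) (cdf ν z) : Set (Ioo (0 : ℝ) 1)) := by
    rw [monotonePlan, Measure.map_apply (by fun_prop) (measurableSet_separated z)]
    refine measure_mono fun u hu => ?_
    simp only [separated, mem_preimage, mem_ofPred_eq, ← not_le, quantile_le_iff] at hu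
    rw [mem_preimage, mem_uIoc]
    grind
  _ ≤ volume (uIoc (cdf μ z) (cdf ν z)) := by
    rw [volume_preimage_coe nullMeasurableSet_Ioo measurableSet_uIoc]
    exact measure_mono inter_subset_left
  _ = edist (cdf μ z) (cdf ν z) := by
    rw [uIoc, Real.volume_Ioc, max_sub_min_eq_abs, edist_dist, Real.dist_eq, abs_sub_comm]

variable [IsProbabilityMeasure μ] [IsProbabilityMeasure ν]

theorem isPlan_monotonePlan : IsPlan (monotonePlan μ ν) μ ν := by
  simpa only [map_quantile, monotonePlan] using
    isPlan_map volume (measurable_quantile μ) (measurable_quantile ν)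

theorem cost_monotonePlan_le :
    cost (monotonePlan μ ν) ≤ ∫⁻ z, edist (cdf μ z) (cdf ν z) := by
  have := (isPlan_monotonePlan μ ν).isFiniteMeasure
  rw [cost_eq_lintegral_separated]
  exact lintegral_mono (measure_monotonePlan_separated_le μ ν)

theorem isOptPlan_monotonePlan : IsOptPlan (monotonePlan μ ν) μ ν :=
  ⟨isPlan_monotonePlan μ ν, fun _ h =>
    (cost_monotonePlan_le μ ν).trans (lintegral_edist_cdf_le_cost h)⟩

theorem cost_monotonePlan : cost (monotonePlan μ ν) = W μ ν :=
  le_antisymm (le_iInf₂ (isOptPlan_monotonePlan μ ν).2) (W_le_cost (isPlan_monotonePlan μ ν))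

theorem lintegral_edist_quantile : ∫⁻ u, edist (quantile μ u) (quantile ν u) = W μ ν := by
  rw [← cost_monotonePlan, cost, monotonePlan, lintegral_map (by fun_prop) (by fun_prop)]

end Quantile

section Line

variable (μ ν : Measure ℝ) [IsProbabilityMeasure μ] [IsProbabilityMeasure ν]

theorem W_eq_lintegral_edist_cdf : W μ ν = ∫⁻ z, edist (cdf μ z) (cdf ν z) :=
  le_antisymm (cost_monotonePlan μ ν ▸ cost_monotonePlan_le μ ν)
    (le_iInf₂ fun _ h => lintegral_edist_cdf_le_cost h)

theorem W_comm : W μ ν = W ν μ := by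
  simp only [W_eq_lintegral_edist_cdf, edist_comm]

theorem W_triangle (ρ : Measure ℝ) [IsProbabilityMeasure ρ] : W μ ρ ≤ W μ ν + W ν ρ := by
  simp only [W_eq_lintegral_edist_cdf]
  rw [← lintegral_add_left
    ((monotone_cdf μ).measurable.edist (monotone_cdf ν).measurable)]
  exact lintegral_mono fun z => edist_triangle _ _ _

variable {μ ν} in
theorem eq_of_W_eq_zero (h : W μ ν = 0) : μ = ν := by
  have hmeas := (measurable_quantile μ).edist (measurable_quantile ν)
  rw [← lintegral_edist_quantile, lintegral_eq_zero_iff hmeas] at h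
  rw [← map_quantile μ, ← map_quantile ν]
  exact Measure.map_congr (h.mono fun u hu => edist_eq_zero.1 hu)

end Line

/-! ### The vector field in quantile coordinates -/

/-- The quantile order `1/2`. -/
def half : Ioo (0 : ℝ) 1 := ⟨1 / 2, by norm_num⟩

/-- The velocity given by the median-splitting field to the quantile of order `u`, which is the
sign of `u - 1/2`. -/
def quantileVel (u : Ioo (0 : ℝ) 1) : ℝ := if u ≤ half then -1 else 1

@[fun_prop]
theorem measurable_quantileVel : Measurable quantileVel :=
  Measurable.ite measurableSet_Iic measurable_const measurable_const

theorem abs_quantileVel (u : Ioo (0 : ℝ) 1) : |quantileVel u| = 1 := by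
  unfold quantileVel
  split_ifs <;> simp

theorem volume_Iic_half : volume (Iic half) = 1 / 2 := by
  have hpre : Iic half = (↑) ⁻¹' Iic (1 / 2 : ℝ) := rfl
  rw [hpre, volume_preimage_coe nullMeasurableSet_Ioo measurableSet_Iic,
    measure_congr ((ae_eq_refl _).inter Ioo_ae_eq_Ioc), inter_comm, Ioc_inter_Iic,
    Real.volume_Ioc, min_eq_right (by norm_num), sub_zero,
    ENNReal.ofReal_div_of_pos two_pos, ENNReal.ofReal_one, ENNReal.ofReal_ofNat]

theorem volume_Ioi_half : volume (Ioi half) = 1 / 2 := by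
  rw [← compl_Iic, prob_compl_eq_one_sub measurableSet_Iic, volume_Iic_half, one_div,
    ENNReal.one_sub_inv_two]

theorem isSplit_map_quantile (μ : Measure ℝ) :
    IsSplit ((volume.restrict (Iic half)).map (quantile μ))
      ((volume.restrict (Ioi half)).map (quantile μ)) (quantile μ half) where
  left_univ := by
    rw [Measure.map_apply (by fun_prop) .univ, preimage_univ, Measure.restrict_apply_univ,
      volume_Iic_half]
  right_univ := by
    rw [Measure.map_apply (by fun_prop) .univ, preimage_univ, Measure.restrict_apply_univ,
      volume_Ioi_half]
  left_Ioi := by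
    have hdisj : quantile μ ⁻¹' Ioi (quantile μ half) ∩ Iic half = ∅ :=
      eq_empty_of_forall_notMem fun _ hu => (monotone_quantile μ hu.2).not_gt hu.1
    rw [Measure.map_apply (by fun_prop) measurableSet_Ioi,
      Measure.restrict_apply (measurable_quantile μ measurableSet_Ioi), hdisj, measure_empty]
  right_Iio := by
    have hdisj : quantile μ ⁻¹' Iio (quantile μ half) ∩ Ioi half = ∅ :=
      eq_empty_of_forall_notMem fun _ hu => (monotone_quantile μ hu.2.le).not_gt hu.1
    rw [Measure.map_apply (by fun_prop) measurableSet_Iio,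
      Measure.restrict_apply (measurable_quantile μ measurableSet_Iio), hdisj, measure_empty]

theorem restrict_Iic_half_add_restrict_Ioi_half :
    volume.restrict (Iic half) + volume.restrict (Ioi half) = volume := by
  rw [← compl_Iic, Measure.restrict_add_restrict_compl measurableSet_Iic]

theorem medianPVF_meas_eq_map_quantile (μ : ProbabilityMeasure ℝ) :
    medianPVF.meas μ = volume.map fun u => (quantile (μ : Measure ℝ) u, quantileVel u) := by
  have hμ : (μ : Measure ℝ) = (volume.restrict (Iic half)).map (quantile (μ : Measure ℝ)) +
      (volume.restrict (Ioi half)).map (quantile (μ : Measure ℝ)) := by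
    rw [← Measure.map_add _ _ (by fun_prop), restrict_Iic_half_add_restrict_Ioi_half, map_quantile]
  have hleft : ∀ᵐ u ∂volume.restrict (Iic half), quantileVel u = -1 :=
    ae_restrict_of_forall_mem measurableSet_Iic fun _ hu => if_pos hu
  have hright : ∀ᵐ u ∂volume.restrict (Ioi half), quantileVel u = 1 :=
    ae_restrict_of_forall_mem measurableSet_Ioi fun _ hu => if_neg hu.not_ge
  rw [(isSplit_map_quantile _).medianPVF_meas_eq hμ, Measure.map_map (by fun_prop) (by fun_prop),
    Measure.map_map (by fun_prop) (by fun_prop)]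
  conv_rhs =>
    rw [← restrict_Iic_half_add_restrict_Ioi_half, Measure.map_add _ _ (by fun_prop)]
  congr 1
  · exact Measure.map_congr (hleft.mono fun u hu => by simp only [Function.comp_apply, hu])
  · exact Measure.map_congr (hright.mono fun u hu => by simp only [Function.comp_apply, hu])

/-- The coupling of `medianPVF[μ]` and `medianPVF[ν]` which identifies the quantile orders: it
projects to the monotone plan from `μ` to `ν`, and couples equal velocities. -/
def quantileCoupling (μ ν : Measure ℝ) : Measure ((ℝ × ℝ) × (ℝ × ℝ)) :=
  volume.map fun u => ((quantile μ u, quantileVel u), (quantile ν u, quantileVel u))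

theorem isPlan_quantileCoupling (μ ν : ProbabilityMeasure ℝ) :
    IsPlan (quantileCoupling μ ν) (medianPVF.meas μ) (medianPVF.meas ν) := by
  rw [medianPVF_meas_eq_map_quantile, medianPVF_meas_eq_map_quantile]
  exact isPlan_map volume (by fun_prop) (by fun_prop)

theorem map_proj13_quantileCoupling (μ ν : Measure ℝ) :
    (quantileCoupling μ ν).map proj13 = monotonePlan μ ν :=
  Measure.map_map (by unfold proj13; fun_prop) (by fun_prop)

theorem fiberW_medianPVF (μ ν : ProbabilityMeasure ℝ) :
    fiberW (medianPVF.meas μ) (medianPVF.meas ν) = 0 := by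
  have hopt : IsOptPlan ((quantileCoupling μ ν).map proj13)
      ((medianPVF.meas μ).map Prod.fst) ((medianPVF.meas ν).map Prod.fst) := by
    rw [map_proj13_quantileCoupling, PVF.meas, PVF.meas, medianPVF.base, medianPVF.base]
    exact isOptPlan_monotonePlan μ ν
  have hcost : ∫⁻ p, edist p.1.2 p.2.2 ∂quantileCoupling μ ν = 0 := by
    rw [quantileCoupling, lintegral_map (by fun_prop) (by fun_prop)]
    simp only [edist_self, lintegral_zero]
  exact le_antisymm (hcost ▸ iInf_le_of_le _
    (iInf_le_of_le (isPlan_quantileCoupling μ ν) (iInf_le_of_le hopt le_rfl))) zero_le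

/-! ### Stability of the flow -/

section Stability

variable (μ ν : Measure ℝ) [IsProbabilityMeasure μ] [IsProbabilityMeasure ν]

theorem spread_eq_map_quantile (t : ℝ) :
    spread μ t = volume.map fun u => quantile μ u + t * quantileVel u := by
  have hμ := medianPVF_meas_eq_map_quantile ⟨μ, inferInstance⟩
  have hspread := map_medianPVF_meas_eq_spread ⟨μ, inferInstance⟩ t
  rw [hμ, Measure.map_map (by fun_prop) (by fun_prop)] at hspread
  exact hspread.symm

theorem W_spread_le (t : ℝ) : W (spread μ t) (spread ν t) ≤ W μ ν := calc
  W (spread μ t) (spread ν t)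
      ≤ ∫⁻ u, edist (quantile μ u + t * quantileVel u) (quantile ν u + t * quantileVel u) := by
    rw [spread_eq_map_quantile μ, spread_eq_map_quantile ν]
    exact W_map_le _ (by fun_prop) (by fun_prop)
  _ = W μ ν := by simp only [edist_add_right, lintegral_edist_quantile]

theorem W_spread_spread_le (t s : ℝ) :
    W (spread μ t) (spread μ s) ≤ ENNReal.ofReal |t - s| := by
  have hdist (u : Ioo (0 : ℝ) 1) :
      edist (quantile μ u + t * quantileVel u) (quantile μ u + s * quantileVel u) =
        ENNReal.ofReal |t - s| := by
    rw [edist_add_left, edist_dist, Real.dist_eq, ← sub_mul, abs_mul, abs_quantileVel, mul_one]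
  rw [spread_eq_map_quantile μ t, spread_eq_map_quantile μ s]
  refine (W_map_le _ (by fun_prop) (by fun_prop)).trans_eq ?_
  simp only [hdist, lintegral_const, measure_univ, mul_one]

end Stability

theorem isLipschitzSemigroup_medianFlow {C : ℝ} (hC : SupportSublinear medianPVF C) (T : ℝ) :
    IsLipschitzSemigroup medianPVF C T medianFlow where
  zero μ := Pc.ext_coe (spread_zero _)
  add μ t _ s hs _ := Pc.ext_coe (spread_spread _ hs.1 t)
  solution := isSolution_medianFlow T
  bounds R hR := by
    refine ⟨1, one_pos, fun μ ν hμ _ t ht s _ => ⟨?_, ?_, ?_⟩⟩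
    · have hexp : 1 + t ≤ Real.exp (C * t) := by
        nlinarith [Real.add_one_le_exp (C * t), one_le_of_supportSublinear hC, ht.1]
      refine (support_spread_subset _ (hμ.trans Metric.ball_subset_closedBall) t).trans
        (Metric.closedBall_subset_ball ?_)
      rw [abs_of_nonneg ht.1]
      nlinarith [ht.1, mul_nonneg ht.1 hR.le]
    · refine (W_spread_le _ _ t).trans (le_mul_of_one_le_left zero_le ?_)
      rw [ENNReal.one_le_ofReal, one_mul]
      exact Real.one_le_exp ht.1
    · rw [one_mul]
      exact W_spread_spread_le _ t s

/-! ### Lattice approximate solutions -/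

theorem map_comp_eq_sum_measure_fiber_smul_dirac {X Y ι : Type*} [MeasurableSpace X]
    [MeasurableSpace Y] [MeasurableSpace ι] [MeasurableSingletonClass ι] [Countable ι]
    {μ : Measure X} {k : X → ι} (hk : Measurable k) {s : Finset ι} (hs : ∀ᵐ x ∂μ, k x ∈ s)
    (y : ι → Y) : μ.map (y ∘ k) = ∑ i ∈ s, μ (k ⁻¹' {i}) • Measure.dirac (y i) := by
  have hy : Measurable y := measurable_of_countable y
  have hnull : ∀ i ∉ s, μ (k ⁻¹' {i}) = 0 := fun i hi =>
    measure_mono_null (fun x (hx : k x = i) (hxs : k x ∈ s) => hi (hx ▸ hxs)) hs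
  ext A hA
  rw [← Measure.map_map hy hk, Measure.map_apply hy hA, Measure.map_eq_sum μ k hk,
    Measure.sum_apply _ (hy hA), Measure.finsetSum_apply,
    tsum_eq_sum fun i hi => by rw [hnull i hi, zero_smul, Measure.coe_zero, Pi.zero_apply]]
  refine Finset.sum_congr rfl fun i _ => ?_
  rw [Measure.smul_apply, Measure.smul_apply, Measure.dirac_apply' _ (hy hA),
    Measure.dirac_apply' _ hA]
  rfl

theorem mem_Ico_div_iff_floor_mul_eq {𝕜 : Type*} [Field 𝕜] [LinearOrder 𝕜] [IsStrictOrderedRing 𝕜]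
    [FloorRing 𝕜] {c : 𝕜} (hc : 0 < c) {x : 𝕜} {i : ℤ} :
    x ∈ Ico (i / c) (i / c + 1 / c) ↔ ⌊x * c⌋ = i := by
  rw [Int.floor_eq_iff, mem_Ico, ← add_div, div_le_iff₀ hc, lt_div_iff₀ hc]

section Grid

variable {N : ℕ}

theorem floor_gridX_mul (hN : 0 < N) (i : ℤ) : ⌊gridX N i * (N : ℝ) ^ 2⌋ = i := by
  rw [gridX, div_mul_cancel₀ _ (by positivity), Int.floor_intCast]

theorem floor_gridV_mul (hN : 0 < N) (j : ℤ) : ⌊gridV N j * (N : ℝ)⌋ = j := by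
  rw [gridV, div_mul_cancel₀ _ (by positivity), Int.floor_intCast]

theorem floor_mul_sq_mem_idxX {x : ℝ} (hx : |x| ≤ N) : ⌊x * (N : ℝ) ^ 2⌋ ∈ idxX N := by
  have hN : (0 : ℝ) ≤ (N : ℝ) ^ 2 := by positivity
  rw [abs_le] at hx
  rw [idxX, Finset.mem_Icc, Int.le_floor, ← Int.cast_le (R := ℝ)]
  push_cast
  exact ⟨by nlinarith, (Int.floor_le _).trans (by nlinarith)⟩

/-- The left end of the cell of the space grid that contains `x`. -/
def gridFloor (N : ℕ) (x : ℝ) : ℝ := gridX N ⌊x * (N : ℝ) ^ 2⌋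

theorem measurable_floor_mul (c : ℝ) : Measurable fun x : ℝ => ⌊x * c⌋ :=
  Int.measurable_floor.comp (measurable_mul_const c)

theorem measurable_gridFloor (N : ℕ) : Measurable (gridFloor N) :=
  (measurable_of_countable (gridX N)).comp (measurable_floor_mul _)

theorem abs_gridFloor_sub_le (hN : 0 < N) (x : ℝ) : |gridFloor N x - x| ≤ 1 / (N : ℝ) ^ 2 := by
  have hpos : (0 : ℝ) < (N : ℝ) ^ 2 := by positivity
  obtain ⟨hle, hlt⟩ := (mem_Ico_div_iff_floor_mul_eq hpos (x := x)).2 rfl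
  rw [gridFloor, gridX, abs_sub_comm, abs_of_nonneg (sub_nonneg.2 hle)]
  linarith

theorem discX_eq_map_gridFloor (hN : 0 < N) {μ : Measure ℝ} (h : ∀ᵐ x ∂μ, |x| ≤ (N : ℝ)) :
    discX N μ = μ.map (gridFloor N) := by
  have hpos : (0 : ℝ) < (N : ℝ) ^ 2 := by positivity
  have hcell (i : ℤ) : Ico (gridX N i) (gridX N i + 1 / (N : ℝ) ^ 2) =
      (fun x : ℝ => ⌊x * (N : ℝ) ^ 2⌋) ⁻¹' {i} :=
    ext fun _ => mem_Ico_div_iff_floor_mul_eq hpos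
  simp only [discX, hcell]
  exact (map_comp_eq_sum_measure_fiber_smul_dirac (measurable_floor_mul _)
    (h.mono fun _ => floor_mul_sq_mem_idxX) (gridX N)).symm

theorem advance_eq_map (hN : 0 < N) {Λ : Measure (ℝ × ℝ)}
    (h : ∀ᵐ p ∂Λ, ∃ i ∈ idxX N, ∃ j ∈ idxV N, p = (gridX N i, gridV N j)) (s : ℝ) :
    advance N Λ s = Λ.map fun p => p.1 + s * p.2 := by
  have hpos : (0 : ℝ) < N := by positivity
  let cell : ℝ × ℝ → ℤ × ℤ := fun p => (⌊p.1 * (N : ℝ) ^ 2⌋, ⌊p.2 * (N : ℝ)⌋)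
  let point : ℤ × ℤ → ℝ := fun k => gridX N k.1 + s * gridV N k.2
  have hcell : Measurable cell := ((measurable_floor_mul _).comp measurable_fst).prodMk
    ((measurable_floor_mul _).comp measurable_snd)
  have hgrid (i j : ℤ) : cell (gridX N i, gridV N j) = (i, j) :=
    Prod.ext (floor_gridX_mul hN i) (floor_gridV_mul hN j)
  have hmass (i j : ℤ) : massV N Λ i j = Λ (cell ⁻¹' {(i, j)}) := by
    refine measure_congr (eventuallyEq_set.2 (h.mono ?_))
    rintro _ ⟨i', -, j', -, rfl⟩
    rw [mem_preimage, hgrid, mem_singleton_iff, Prod.mk_inj, mem_prod, mem_singleton_iff]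
    exact and_congr ⟨fun (hi : gridX N i' = gridX N i) => by rw [← floor_gridX_mul hN i', hi,
      floor_gridX_mul hN], congrArg (gridX N)⟩
      ((mem_Ico_div_iff_floor_mul_eq hpos).trans (by rw [floor_gridV_mul hN]))
  have hmem : ∀ᵐ p ∂Λ, cell p ∈ idxX N ×ˢ idxV N := h.mono <| by
    rintro _ ⟨i, hi, j, hj, rfl⟩
    exact hgrid i j ▸ Finset.mk_mem_product hi hj
  have hmove : (fun p => p.1 + s * p.2) =ᵐ[Λ] point ∘ cell := h.mono <| by
    rintro _ ⟨i, -, j, -, rfl⟩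
    rw [Function.comp_apply, hgrid]
  rw [Measure.map_congr hmove, map_comp_eq_sum_measure_fiber_smul_dirac hcell hmem,
    Finset.sum_product]
  simp only [advance, hmass, point]

/-- `μ` is carried by the points of the unbounded space grid that lie in `[-M, M]`. -/
def OnGrid (N : ℕ) (M : ℝ) (μ : Measure ℝ) : Prop :=
  ∀ᵐ x ∂μ, x ∈ range (gridX N) ∩ Metric.closedBall 0 M

theorem measurableSet_range_gridX_inter_closedBall (N : ℕ) (M : ℝ) :
    MeasurableSet {x | x ∈ range (gridX N) ∩ Metric.closedBall 0 M} :=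
  (countable_range _).measurableSet.inter Metric.isClosed_closedBall.measurableSet

theorem OnGrid.mono {μ : Measure ℝ} {M M' : ℝ} (h : OnGrid N M μ) (hM : M ≤ M') :
    OnGrid N M' μ :=
  Eventually.mono h fun _ hx => ⟨hx.1, Metric.closedBall_subset_closedBall hM hx.2⟩

theorem gridX_add_intCast_div (hN : 0 < N) (i ℓ : ℤ) :
    gridX N i + ℓ / N = gridX N (i + ℓ * N) := by
  simp only [gridX]
  push_cast
  field_simp

theorem OnGrid.spread (hN : 0 < N) {μ : Measure ℝ} [IsProbabilityMeasure μ] {M : ℝ}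
    (h : OnGrid N M μ) (ℓ : ℕ) : OnGrid N (M + ℓ / N) (spread μ (ℓ / N)) := by
  have hℓ : |(ℓ : ℝ) / N| = ℓ / N := abs_of_nonneg (by positivity)
  refine ae_spread μ (measurableSet_range_gridX_inter_closedBall N _) (Eventually.mono h ?_)
  rintro _ ⟨⟨i, rfl⟩, hi⟩
  simp only [mem_inter_iff, mem_closedBall_zero_iff, Real.norm_eq_abs] at hi ⊢
  refine ⟨⟨⟨i + -ℓ * N, ?_⟩, (abs_sub _ _).trans (by linarith)⟩,
    ⟨i + ℓ * N, ?_⟩, (abs_add_le _ _).trans (by linarith)⟩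
  · rw [← gridX_add_intCast_div hN, Int.cast_neg, Int.cast_natCast, neg_div, ← sub_eq_add_neg]
  · rw [← gridX_add_intCast_div hN, Int.cast_natCast]

theorem exists_gridV_eq_of_eq_neg_one_or_eq_one (hN : 0 < N) {v : ℝ} (hv : v = -1 ∨ v = 1) :
    ∃ j ∈ idxV N, v = gridV N j := by
  have hpos : (N : ℝ) ≠ 0 := by positivity
  have hsq : (N : ℤ) ≤ (N : ℤ) ^ 2 := by exact_mod_cast Nat.le_self_pow two_ne_zero N
  simp only [idxV, Finset.mem_Icc, gridV]
  rcases hv with rfl | rfl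
  · exact ⟨-N, ⟨by lia, by lia⟩, by push_cast; rw [neg_div, div_self hpos]⟩
  · exact ⟨N, ⟨by lia, by lia⟩, by push_cast; rw [div_self hpos]⟩

theorem advance_medianPVF (hN : 0 < N) {μ : Measure ℝ} [IsProbabilityMeasure μ]
    (h : OnGrid N N μ) (s : ℝ) : advance N (medianPVF.ext μ) s = spread μ s := by
  obtain ⟨μ, rfl⟩ : ∃ ν : ProbabilityMeasure ℝ, (ν : Measure ℝ) = μ := ⟨⟨μ, inferInstance⟩, rfl⟩
  have hext : medianPVF.ext μ = medianPVF.meas μ := dif_pos μ.2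
  rw [OnGrid, ← medianPVF.base μ] at h
  have hbase := ae_of_ae_map measurable_fst.aemeasurable h
  rw [hext, ← map_medianPVF_meas_eq_spread μ]
  refine advance_eq_map hN ?_ s
  filter_upwards [hbase, ae_medianPVF_meas μ] with p ⟨⟨i, hi⟩, hp⟩ hv
  obtain ⟨j, hj, hpj⟩ := exists_gridV_eq_of_eq_neg_one_or_eq_one hN hv
  rw [← hi, mem_closedBall_zero_iff, Real.norm_eq_abs] at hp
  exact ⟨i, floor_gridX_mul hN i ▸ floor_mul_sq_mem_idxX hp, j, hj, Prod.ext hi.symm hpj⟩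

theorem onGrid_map_gridFloor (hN : 0 < N) {μ : Measure ℝ} {R : ℝ} (h : ∀ᵐ x ∂μ, |x| ≤ R) :
    OnGrid N (R + 1) (μ.map (gridFloor N)) := by
  have hstep : 1 / (N : ℝ) ^ 2 ≤ 1 :=
    div_le_one_of_le₀ (one_le_pow₀ (Nat.one_le_cast.2 hN)) (by positivity)
  rw [OnGrid, ae_map_iff (measurable_gridFloor N).aemeasurable
    (measurableSet_range_gridX_inter_closedBall N _)]
  refine h.mono fun x hx => ⟨⟨_, rfl⟩, ?_⟩
  rw [mem_closedBall_zero_iff, Real.norm_eq_abs]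
  linarith [abs_gridFloor_sub_le hN x, abs_sub_abs_le_abs_sub (gridFloor N x) x]

theorem W_map_gridFloor_le (hN : 0 < N) (μ : Measure ℝ) [IsProbabilityMeasure μ] :
    W (μ.map (gridFloor N)) μ ≤ ENNReal.ofReal (1 / (N : ℝ) ^ 2) := calc
  W (μ.map (gridFloor N)) μ ≤ ∫⁻ x, edist (gridFloor N x) x ∂μ := by
    simpa only [Measure.map_id, id] using W_map_le μ (measurable_gridFloor N) measurable_id
  _ ≤ ∫⁻ _, ENNReal.ofReal (1 / (N : ℝ) ^ 2) ∂μ := lintegral_mono fun x => by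
    rw [edist_dist, Real.dist_eq]
    exact ENNReal.ofReal_le_ofReal (abs_gridFloor_sub_le hN x)
  _ = ENNReal.ofReal (1 / (N : ℝ) ^ 2) := by rw [lintegral_const, measure_univ, mul_one]

section Datum

variable {μ : Measure ℝ} [IsProbabilityMeasure μ] {R T : ℝ}

instance : IsProbabilityMeasure (μ.map (gridFloor N)) :=
  Measure.isProbabilityMeasure_map (measurable_gridFloor N).aemeasurable

theorem lasStep_medianPVF (hN : 0 < N) (h : ∀ᵐ x ∂μ, |x| ≤ R) (hR : R + 1 + T ≤ N) (ℓ : ℕ)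
    (hℓ : (ℓ : ℝ) / N ≤ T) :
    lasStep medianPVF N μ ℓ = spread (μ.map (gridFloor N)) (ℓ / N) := by
  have hT : 0 ≤ T := le_trans (by positivity) hℓ
  induction ℓ with
  | zero =>
    rw [lasStep, discX_eq_map_gridFloor hN (h.mono fun x hx => by linarith), Nat.cast_zero,
      zero_div, spread_zero]
  | succ ℓ ih =>
    have hle : (ℓ : ℝ) / N ≤ T := le_trans (by gcongr; simp) hℓ
    have hgrid : OnGrid N N (spread (μ.map (gridFloor N)) (ℓ / N)) :=
      ((onGrid_map_gridFloor hN h).spread hN ℓ).mono (by linarith)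
    rw [lasStep, ih hle, advance_medianPVF hN hgrid, spread_spread _ (by positivity), ← add_div,
      Nat.cast_succ, add_comm (1 : ℝ)]

theorem las_medianPVF (hN : 0 < N) (h : ∀ᵐ x ∂μ, |x| ≤ R) (hR : R + 1 + T ≤ N) {t : ℝ}
    (ht : t ∈ Icc 0 T) : las medianPVF N μ t = spread (μ.map (gridFloor N)) t := by
  have hpos : (0 : ℝ) < N := by positivity
  have hle : (⌊t * (N : ℝ)⌋₊ : ℝ) / N ≤ T := by
    refine le_trans ?_ ht.2
    rw [div_le_iff₀ hpos]
    exact Nat.floor_le (mul_nonneg ht.1 hpos.le)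
  have hgrid : OnGrid N N (spread (μ.map (gridFloor N)) (⌊t * (N : ℝ)⌋₊ / N)) :=
    ((onGrid_map_gridFloor hN h).spread hN _).mono (by linarith)
  rw [las, lasStep_medianPVF hN h hR _ hle, advance_medianPVF hN hgrid,
    spread_spread _ (by positivity), sub_add_cancel]

end Datum

end Grid

theorem eventually_las_medianPVF (T : ℝ) (μ : Pc) : ∀ᶠ N : ℕ in atTop, ∀ t ∈ Icc 0 T,
    IsProbabilityMeasure (las medianPVF N (μ.1 : Measure ℝ) t) ∧
    W (las medianPVF N (μ.1 : Measure ℝ) t) ((medianFlow t μ).1 : Measure ℝ) ≤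
      ENNReal.ofReal (1 / (N : ℝ) ^ 2) := by
  obtain ⟨R, hR⟩ := μ.exists_supp_subset
  have hbdd : ∀ᵐ x ∂(μ.1 : Measure ℝ), |x| ≤ R :=
    ((support_subset_iff_ae Metric.isClosed_closedBall).1 hR).mono fun _ => by simp
  filter_upwards [eventually_gt_atTop 0,
    tendsto_natCast_atTop_atTop.eventually_ge_atTop (R + 1 + T)] with N hN hNR t ht
  rw [las_medianPVF hN hbdd hNR ht, coe_medianFlow]
  exact ⟨inferInstance, (W_spread_le _ _ t).trans (W_map_gridFloor_le hN _)⟩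

theorem tendsto_ofReal_one_div_natCast_sq :
    Tendsto (fun N : ℕ => ENNReal.ofReal (1 / (N : ℝ) ^ 2)) atTop (𝓝 0) := by
  have hreal : Tendsto (fun N : ℕ => 1 / (N : ℝ) ^ 2) atTop (𝓝 0) :=
    tendsto_const_nhds.div_atTop
      ((tendsto_pow_atTop two_ne_zero).comp tendsto_natCast_atTop_atTop)
  simpa only [ENNReal.ofReal_zero] using ENNReal.tendsto_ofReal hreal

theorem lasTendsto_medianFlow (T : ℝ) (μ : Pc) :
    LASTendsto medianPVF T μ (fun N => N) (fun t => medianFlow t μ) := by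
  refine tendsto_of_tendsto_of_tendsto_of_le_of_le' tendsto_const_nhds
    tendsto_ofReal_one_div_natCast_sq (.of_forall fun _ => zero_le) ?_
  filter_upwards [eventually_las_medianPVF T μ] with N hN
  exact iSup₂_le fun t ht => (hN t ht).2

theorem eq_medianFlow_of_lasTendsto {T : ℝ} {μ : Pc} {φ : ℕ → ℕ} {ρ : ℝ → Pc}
    (hφ : Tendsto φ atTop atTop) (h : LASTendsto medianPVF T μ φ ρ) {t : ℝ} (ht : t ∈ Icc 0 T) :
    ρ t = medianFlow t μ := by
  refine Pc.ext_coe (eq_of_W_eq_zero (le_zero_iff.1 ?_))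
  have hlim := h.add (tendsto_ofReal_one_div_natCast_sq.comp hφ)
  rw [add_zero] at hlim
  refine ge_of_tendsto hlim ?_
  filter_upwards [hφ.eventually (eventually_las_medianPVF T μ)] with k hk
  have := (hk t ht).1
  refine (W_triangle _ (las medianPVF (φ k) (μ.1 : Measure ℝ) t) _).trans
    (add_le_add ?_ (hk t ht).2)
  rw [W_comm]
  exact le_iSup₂ (f := fun t (_ : t ∈ Icc (0 : ℝ) T) =>
    W (las medianPVF (φ k) (μ.1 : Measure ℝ) t) ((ρ t).1 : Measure ℝ)) t ht

end MDE

end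

theorem proposition6p4 :
    H1 medianPVF ∧
    H3 medianPVF ∧
    (∀ μ ν : Pc, fiberW (medianPVF.meas μ.1) (medianPVF.meas ν.1) = 0) ∧
    ∀ T : ℝ, 0 < T → ∃ S : ℝ → Pc → Pc,
      -- the lattice approximate solutions converge, and have no other limit,
      -- even along subsequences
      (∀ μ₀ : Pc, LASTendsto medianPVF T μ₀ (fun N => N) (fun t => S t μ₀)) ∧
      (∀ (μ₀ : Pc) (φ : ℕ → ℕ) (ρ : ℝ → Pc), StrictMono φ →
        LASTendsto medianPVF T μ₀ φ ρ → ∀ t ∈ Icc (0 : ℝ) T, ρ t = S t μ₀) ∧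
      -- `S` is the unique Lipschitz semigroup whose trajectories are limits of
      -- lattice approximate solutions
      (∀ C : ℝ, 0 < C → SupportSublinear medianPVF C →
        IsLipschitzSemigroup medianPVF C T S ∧
        ∀ S' : ℝ → Pc → Pc, IsLipschitzSemigroup medianPVF C T S' →
          (∀ μ₀ : Pc, ∃ φ : ℕ → ℕ, StrictMono φ ∧
            LASTendsto medianPVF T μ₀ φ (fun t => S' t μ₀)) →
          ∀ t ∈ Icc (0 : ℝ) T, ∀ μ₀ : Pc, S' t μ₀ = S t μ₀) ∧
      -- the explicit formula
      (∀ μ₀ : Pc, ∀ t ∈ Icc (0 : ℝ) T, ∀ A : Set ℝ, MeasurableSet A →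
        ((S t μ₀).1 : Measure ℝ) A =
          (μ₀.1 : Measure ℝ) ((fun x => x + t) '' (A ∩ Iio (med (μ₀.1 : Measure ℝ) - t))) +
          (μ₀.1 : Measure ℝ) ((fun x => x - t) '' (A ∩ Ioi (med (μ₀.1 : Measure ℝ) + t))) +
          massR (μ₀.1 : Measure ℝ) * Measure.dirac (med (μ₀.1 : Measure ℝ) + t) A +
          massL (μ₀.1 : Measure ℝ) * Measure.dirac (med (μ₀.1 : Measure ℝ) - t) A) ∧
      -- the solution that starts from a Dirac mass
      (∀ (x₀ : ℝ) (μ₀ : Pc), (μ₀.1 : Measure ℝ) = Measure.dirac x₀ → ∀ t ∈ Icc (0 : ℝ) T,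
        ((S t μ₀).1 : Measure ℝ) =
          (1 / 2 : ℝ≥0∞) • Measure.dirac (x₀ + t) + (1 / 2 : ℝ≥0∞) • Measure.dirac (x₀ - t)) ∧
      -- the solution that starts from the uniform probability measure on `[a, b]`
      (∀ (a b : ℝ) (μ₀ : Pc), a < b →
        (μ₀.1 : Measure ℝ) = (ENNReal.ofReal (b - a))⁻¹ • volume.restrict (Icc a b) →
        ∀ t ∈ Icc (0 : ℝ) T,
          ((S t μ₀).1 : Measure ℝ) =
            (ENNReal.ofReal (b - a))⁻¹ • volume.restrict (Icc (a - t) ((a + b) / 2 - t)) +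
            (ENNReal.ofReal (b - a))⁻¹ • volume.restrict (Icc ((a + b) / 2 + t) (b + t))) := by
  refine ⟨⟨1, one_pos, supportSublinear_one⟩,
    fun R _ => ⟨1, one_pos, fun μ ν _ _ => (fiberW_medianPVF μ.1 ν.1).trans_le zero_le⟩,
    fun μ ν => fiberW_medianPVF μ.1 ν.1, fun T _ => ⟨medianFlow, lasTendsto_medianFlow T,
      fun μ₀ φ ρ hφ h t ht => eq_medianFlow_of_lasTendsto hφ.tendsto_atTop h ht,
      fun C _ hC => ⟨isLipschitzSemigroup_medianFlow hC T, fun S' _ h t ht μ₀ => ?_⟩,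
      fun μ₀ t _ A hA => spread_apply _ t hA, fun x₀ μ₀ h t _ => ?_,
      fun a b μ₀ hab h t _ => ?_⟩⟩
  · obtain ⟨φ, hφ, hlim⟩ := h μ₀
    exact eq_medianFlow_of_lasTendsto hφ.tendsto_atTop hlim ht
  · rw [coe_medianFlow, h, spread_dirac]
  · rw [coe_medianFlow, h, spread_uniform hab]
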